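/- Let $n\ge 4$ and let $S_n$ act by permutation of the bases on $W=\bigoplus_{i=1}^n\mathbb{C}y_i$ and on $W^*=\bigoplus_{i=1}^n\mathbb{C}x_i$ ($x_1,\dots,x_n$ the dual basis). Put $\bar x_i=x_i-\frac1n\sum_k x_k$ and $\bar y_i=y_i-\frac1n\sum_k y_k$, and let $\mathfrak h^*=\mathrm{span}\{\bar x_i\}$, $\mathfrak h=\mathrm{span}\{\bar y_i\}$, so that $V=\mathfrak h^*\oplus\mathfrak h\cong\mathbb{C}^{2n-2}$ is the doubled standard representation of $G=S_n$; write ${}^gv$ for the action. A parameter map is $\kappa=\kappa^L+\kappa^C$ with $\kappa^L=\sum_{g\in G}\kappa^L_g\,g$, $\kappa^C=\sum_{g\in G}\kappa^C_g\,g$, where $\kappa^L_g:\bigwedge^2V\to V$ and $\kappa^C_g:\bigwedge^2V\to\mathbb{C}$ are linear. It is a Drinfeld orbifold algebra map if for all $g,h\in G$ and $v_1,v_2,v_3\in V$ (sums over $\sigma$ in the alternating group $\mathrm{Alt}_3$): - $\operatorname{im}\kappa^L_g\subseteq V^g$; - $\kappa$ is $G$-invariant: ${}^h(\kappa^L_g({}^{h^{-1}}v_1,{}^{h^{-1}}v_2))=\kappa^L_{hgh^{-1}}(v_1,v_2)$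 and $\kappa^C_g({}^{h^{-1}}v_1,{}^{h^{-1}}v_2)=\kappa^C_{hgh^{-1}}(v_1,v_2)$; - $\sum_{\sigma}\kappa^L_g(v_{\sigma(2)},v_{\sigma(3)})({}^gv_{\sigma(1)}-v_{\sigma(1)})=0$ in the symmetric algebra $S(V)$; - $\sum_{\sigma}\sum_{xy=g}\kappa^L_x(v_{\sigma(1)}+{}^yv_{\sigma(1)},\kappa^L_y(v_{\sigma(2)},v_{\sigma(3)}))=2\sum_{\sigma}\kappa^C_g(v_{\sigma(2)},v_{\sigma(3)})({}^gv_{\sigma(1)}-v_{\sigma(1)})$; - $\sum_{\sigma}\sum_{xy=g}\kappa^C_x(v_{\sigma(1)}+{}^yv_{\sigma(1)},\kappa^L_y(v_{\sigma(2)},v_{\sigma(3)}))=0$. For $a^\perp,b^\perp,c\in\mathbb{C}$ consider the following conditions, for all $1\le i\ne j\le n$, on a parameter map $\kappa$, regarded as a map $\bigwedge^2V\to(V\oplus\mathbb{C})\otimes\mathbb{C}S_n$: \begin{align*} \kappa(\bar x_i,\bar x_j)&=\tfrac{n^2}{4}(b^\perp)^2\sum_{k\ne i,j}\big((ijk)-(kji)\big),\\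 \kappa(\bar y_i,\bar y_j)&=\tfrac{n^2}{4}(a^\perp)^2\sum_{k\ne i,j}\big((ijk)-(kji)\big),\\ \kappa(\bar x_i,\bar y_i)&=-\sum_{k\ne i}\Big[\tfrac n2\big(a^\perp(\bar x_i+\bar x_k)+b^\perp(\bar y_i+\bar y_k)\big)-c\Big]\otimes(ik),\\ \kappa(\bar x_i,\bar y_j)&=\Big[\tfrac n2\big(a^\perp(\bar x_i+\bar x_j)+b^\perp(\bar y_i+\bar y_j)\big)-c\Big]\otimes(ij)-\tfrac{n^2}{4}a^\perp b^\perp\sum_{k\ne i,j}\big((ijk)-(kji)\big). \end{align*} Then: 1. A parameter map $\kappa$ is a Drinfeld orbifold algebra map with $\kappa^L\neq0$ supported only off the identity (i.e. $\kappa^L_1=0$) if and only if it satisfies these conditions for some $a^\perp,b^\perp,c\in\mathbb{C}$ with $(a^\perp,b^\perp)\ne(0,0)$. 2. For all $a^\perp,b^\perp,c\in\mathbb{C}$ there is exactly one parameter map satisfying these conditions, and it is a Drinfeld orbifold algebra map. 3. For $a^\perp=b^\perp=0$ the conditions say exactly that $\kappa$ gives the commutator relations of the rational Cherednik algebra $H_{0,c}$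 of $S_n$: $\kappa(x,x')=0$, $\kappa(y,y')=0$ and $\kappa(x,y)=c\sum_{i<j}\langle x_i-x_j,y\rangle\langle x,y_i-y_j\rangle\,(ij)$ for all $x,x'\in\mathfrak h^*$ and $y,y'\in\mathfrak h$. -/

import Mathlib

namespace DrinfeldOrbifold

noncomputable section

/-- A parameter map `κ = κ^L + κ^C`: a linear 2-cochain `lin = ∑ g, κ^L_g g` and a constant
2-cochain `const = ∑ g, κ^C_g g`, with components alternating bilinear maps on `V` with values in
`V` and in `ℂ` respectively. -/
@[ext]
structure ParamMap (G V : Type*) [AddCommGroup V] [Module ℂ V] where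
  lin : G → V →ₗ[ℂ] V →ₗ[ℂ] V
  const : G → V →ₗ[ℂ] V →ₗ[ℂ] ℂ
  lin_alt : ∀ g, (lin g).IsAlt
  const_alt : ∀ g, (const g).IsAlt

section General

variable {G V : Type*} [AddCommGroup V] [Module ℂ V]

/-- The value `κ(u, v)` in `(V ⊕ ℂ) ⊗ ℂG`. For a finite group `G` this space is identified with the
functions `G → V × ℂ`; the simple tensor `(w + z) ⊗ g` is `Pi.single g (w, z)`. -/
def ParamMap.val (κ : ParamMap G V) (u v : V) : G → V × ℂ :=
  fun g => (κ.lin g u v, κ.const g u v)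

/-- The sum of `F` over the even (that is, cyclic) rearrangements of `v₁, v₂, v₃`. -/
def cyclicSum {M : Type*} [AddCommMonoid M] (F : V → V → V → M) (v₁ v₂ v₃ : V) : M :=
  F v₁ v₂ v₃ + F v₂ v₃ v₁ + F v₃ v₁ v₂

/-- Drinfeld orbifold algebra maps for a finite group `G` acting linearly on `V` through `ρ`.
The pairs `(x, y)` with `x * y = g` are enumerated as `(x, x⁻¹ * g)`. -/
structure IsDrinfeldOrbifoldAlgebraMap [Group G] [Fintype G]
    (ρ : Representation ℂ G V) (κ : ParamMap G V) : Prop where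
  /-- The image of `κ^L_g` lies in the fixed space of `g`. -/
  image_fixed : ∀ g v w, ρ g (κ.lin g v w) = κ.lin g v w
  /-- `κ^L` is `G`-invariant. -/
  lin_invariant : ∀ g h v w,
    ρ h (κ.lin g (ρ h⁻¹ v) (ρ h⁻¹ w)) = κ.lin (h * g * h⁻¹) v w
  /-- `κ^C` is `G`-invariant. -/
  const_invariant : ∀ g h v w,
    κ.const g (ρ h⁻¹ v) (ρ h⁻¹ w) = κ.const (h * g * h⁻¹) v w
  /-- The mixed Jacobi identity for `κ^L`, in the symmetric algebra `S(V)`. -/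
  mixed_jacobi : ∀ g v₁ v₂ v₃,
    cyclicSum (fun u v w => SymmetricAlgebra.ι ℂ V (κ.lin g v w) *
      SymmetricAlgebra.ι ℂ V (ρ g u - u)) v₁ v₂ v₃ = 0
  /-- The first obstruction. -/
  first_obstruction : ∀ g v₁ v₂ v₃,
    cyclicSum (fun u v w => ∑ x : G,
      κ.lin x (u + ρ (x⁻¹ * g) u) (κ.lin (x⁻¹ * g) v w)) v₁ v₂ v₃ =
    (2 : ℂ) • cyclicSum (fun u v w => κ.const g v w • (ρ g u - u)) v₁ v₂ v₃
  /-- The second obstruction. -/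
  second_obstruction : ∀ g v₁ v₂ v₃,
    cyclicSum (fun u v w => ∑ x : G,
      κ.const x (u + ρ (x⁻¹ * g) u) (κ.lin (x⁻¹ * g) v w)) v₁ v₂ v₃ = 0

end General

/-- The natural permutation representation of `S_n` on `ℂⁿ`: the standard basis vector `e_i` is
sent by `σ` to `e_{σ i}`. -/
def permRep (n : ℕ) : Representation ℂ (Equiv.Perm (Fin n)) (Fin n → ℂ) where
  toFun σ := LinearMap.funLeft ℂ ℂ σ.symm
  map_one' := rfl
  map_mul' _ _ := rfl

/-- The subspace of `ℂⁿ` of vectors with coordinate sum zero, that is, the orthogonal complement of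
`e_1 + ⋯ + e_n`. -/
def stdSpace (n : ℕ) : Submodule ℂ (Fin n → ℂ) where
  carrier := {w | ∑ i, w i = 0}
  add_mem' := by
    intro u v hu hv
    simp only [Set.mem_ofPred_eq, Pi.add_apply, Finset.sum_add_distrib] at *
    simp [hu, hv]
  zero_mem' := by simp
  smul_mem' := by
    intro c u hu
    simp only [Set.mem_ofPred_eq, Pi.smul_apply, smul_eq_mul, ← Finset.mul_sum] at *
    simp [hu]

/-- The standard representation of `S_n`. -/
def stdRep (n : ℕ) : Representation ℂ (Equiv.Perm (Fin n)) (stdSpace n) :=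
  (permRep n).subrepresentation (stdSpace n) fun σ w hw =>
    (Equiv.sum_comp σ.symm w).trans hw

/-- The space `𝔥* ⊕ 𝔥`. The first factor is written in coordinates with respect to the basis
`x_1, …, x_n` of `W*` dual to the basis `y_1, …, y_n` of `W`, the second in coordinates with respect
to `y_1, …, y_n`. Both bases are permuted by `S_n`. -/
abbrev DoubledStd (n : ℕ) : Type := stdSpace n × stdSpace n

/-- The doubled standard representation of `S_n` on `𝔥* ⊕ 𝔥`. -/
def doubledStdRep (n : ℕ) : Representation ℂ (Equiv.Perm (Fin n)) (DoubledStd n) :=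
  (stdRep n).prod (stdRep n)

/-- The vector `e_i - (1/n) (e_1 + ⋯ + e_n)`. -/
def bar {n : ℕ} (i : Fin n) : stdSpace n :=
  ⟨fun j => (if j = i then 1 else 0) - 1 / (n : ℂ), by
    have hn : (n : ℂ) ≠ 0 := Nat.cast_ne_zero.mpr (Nat.ne_zero_of_lt i.isLt)
    change ∑ j, ((if j = i then (1 : ℂ) else 0) - 1 / (n : ℂ)) = 0
    simp [Finset.sum_sub_distrib, hn]⟩

/-- `x̄_i = x_i - (1/n) (x_1 + ⋯ + x_n)`. -/
def xbar {n : ℕ} (i : Fin n) : DoubledStd n := (bar i, 0)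

/-- `ȳ_i = y_i - (1/n) (y_1 + ⋯ + y_n)`. -/
def ybar {n : ℕ} (i : Fin n) : DoubledStd n := (0, bar i)

/-- For distinct `i, j, k`, the 3-cycle `(i j k)` sending `i` to `j`, `j` to `k` and `k` to `i`. -/
def cycle3 {n : ℕ} (i j k : Fin n) : Equiv.Perm (Fin n) := Equiv.swap i j * Equiv.swap j k

/-- The element `z ∑_{k ≠ i, j} ((i j k) - (k j i))`. -/
def cycleSum {n : ℕ} (z : ℂ) (i j : Fin n) : Equiv.Perm (Fin n) → DoubledStd n × ℂ :=
  ∑ k : Fin n with k ≠ i ∧ k ≠ j, (Pi.single (cycle3 i j k) (0, z) - Pi.single (cycle3 k j i) (0, z))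

/-- The element `[(n/2) (a (x̄_i + x̄_j) + b (ȳ_i + ȳ_j)) - c] ⊗ (i j)`. -/
def swapTerm {n : ℕ} (a b c : ℂ) (i j : Fin n) : Equiv.Perm (Fin n) → DoubledStd n × ℂ :=
  Pi.single (Equiv.swap i j)
    (((n : ℂ) / 2) • (a • (xbar i + xbar j) + b • (ybar i + ybar j)), -c)

/-- `κ` is the member of the three-parameter family with parameters `a = a^⊥`, `b = b^⊥` and `c`. -/
structure InFamily {n : ℕ} (a b c : ℂ) (κ : ParamMap (Equiv.Perm (Fin n)) (DoubledStd n)) :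
    Prop where
  xx : ∀ i j, i ≠ j → κ.val (xbar i) (xbar j) = cycleSum ((n : ℂ) ^ 2 / 4 * b ^ 2) i j
  yy : ∀ i j, i ≠ j → κ.val (ybar i) (ybar j) = cycleSum ((n : ℂ) ^ 2 / 4 * a ^ 2) i j
  xy_same : ∀ i, κ.val (xbar i) (ybar i) = -∑ k : Fin n with k ≠ i, swapTerm a b c i k
  xy : ∀ i j, i ≠ j → κ.val (xbar i) (ybar j) =
    swapTerm a b c i j - cycleSum ((n : ℂ) ^ 2 / 4 * (a * b)) i j

/-- `κ` gives the commutator relations of the rational Cherednik algebra `H_{0,c}` of `S_n`: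
`[x, x'] = 0`, `[y, y'] = 0` and `[x, y] = c ∑_s ⟨α_s, y⟩ ⟨x, α_s^∨⟩ s` for `x, x' ∈ 𝔥*` and
`y, y' ∈ 𝔥`, the sum being over the transpositions `s = (i j)`, `i < j`, with
`α_s = x_i - x_j` and `α_s^∨ = y_i - y_j`. -/
structure IsCherednikMap {n : ℕ} (c : ℂ) (κ : ParamMap (Equiv.Perm (Fin n)) (DoubledStd n)) :
    Prop where
  xx : ∀ x x' : stdSpace n, κ.val (x, 0) (x', 0) = 0
  yy : ∀ y y' : stdSpace n, κ.val (0, y) (0, y') = 0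
  xy : ∀ x y : stdSpace n, κ.val (x, 0) (0, y) =
    ∑ p : Fin n × Fin n with p.1 < p.2,
      Pi.single (Equiv.swap p.1 p.2)
        (0, c * ((y.1 p.1 - y.1 p.2) * (x.1 p.1 - x.1 p.2)))

end

end DrinfeldOrbifold

namespace DrinfeldOrbifold

open Equiv

noncomputable section

/-! ### Coordinates on the doubled standard representation -/

section Basic

variable {n : ℕ}

/-! The conditions fix `κ` on spanning vectors, so they describe one explicit map `family`. On a
transposition `g` its linear part is `reflForm g` times the vector `moved a b g` and its constant
part is `c • reflForm g`. On a 3-cycle it is a multiple of `cycleForm`, built from the combination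
`mix = b x - a y`, which vanishes on every `moved` vector.

That `family` satisfies the axioms rests on identities in the exterior algebra. A product of two
transpositions contributes to an obstruction only if it is a 3-cycle, which has three such
factorizations. The three contributions add up to zero (`cyclicSum_composite`), and separately each
is matched by `cycleForm` (`cyclicSum_composite_fst`, `cyclicSum_composite_snd`).

Conversely, pairing the mixed Jacobi identity with a `g`-invariant functional turns `κ^L_g` into a
scalar form `δ` for which the cyclic sum of `δ(v, w) (gu - u)` vanishes. Such a `δ` is zero when `g
- 1` has rank above 2, and a multiple of `reflForm` when `g` is a transposition. Invariance under
the stabilizer of a pair then leaves the parameters `a`, `b`. With `κ^L` known, the first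
obstruction determines `κ^C` up to solutions of the same homogeneous equation, which adds only `c`
off the identity. At the identity that equation is empty; there invariance and the second
obstruction force `κ^C_1 = 0`, because `(a, b) ≠ 0`. -/

@[simp]
theorem doubledStdRep_fst_apply (σ : Perm (Fin n)) (v : DoubledStd n) (k : Fin n) :
    (doubledStdRep n σ v).1.1 k = v.1.1 (σ.symm k) := rfl

@[simp]
theorem doubledStdRep_snd_apply (σ : Perm (Fin n)) (v : DoubledStd n) (k : Fin n) :
    (doubledStdRep n σ v).2.1 k = v.2.1 (σ.symm k) := rfl

theorem bar_apply (i k : Fin n) : (bar i).1 k = (if k = i then 1 else 0) - 1 / (n : ℂ) := rfl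

theorem doubledStd_ext {v w : DoubledStd n} (h₁ : ∀ k, v.1.1 k = w.1.1 k)
    (h₂ : ∀ k, v.2.1 k = w.2.1 k) : v = w :=
  Prod.ext (Subtype.ext (funext h₁)) (Subtype.ext (funext h₂))

theorem doubledStdRep_xbar (σ : Perm (Fin n)) (i : Fin n) :
    doubledStdRep n σ (xbar i) = xbar (σ i) := by
  refine doubledStd_ext (fun k => ?_) fun k => rfl
  simp [xbar, bar_apply, Equiv.symm_apply_eq]

theorem doubledStdRep_ybar (σ : Perm (Fin n)) (i : Fin n) :
    doubledStdRep n σ (ybar i) = ybar (σ i) := by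
  refine doubledStd_ext (fun k => rfl) fun k => ?_
  simp [ybar, bar_apply, Equiv.symm_apply_eq]

/-- The `1/n` corrections are multiplied by the coordinate sum of `u`, which is zero. -/
theorem sum_smul_bar (u : stdSpace n) : ∑ i, u.1 i • bar i = u := by
  have hu : ∑ i, u.1 i = 0 := u.2
  refine Subtype.ext (funext fun k => ?_)
  simp [bar_apply, mul_sub, Finset.sum_sub_distrib, ← Finset.sum_mul, hu]

theorem doubledStd_eq_sum (v : DoubledStd n) :
    v = ∑ i, v.1.1 i • xbar i + ∑ i, v.2.1 i • ybar i := by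
  refine Prod.ext ?_ ?_
  · simp [xbar, ybar, Prod.fst_sum, sum_smul_bar]
  · simp [xbar, ybar, Prod.snd_sum, sum_smul_bar]

/-- Linear maps on `𝔥* ⊕ 𝔥` agree if they agree on the vectors `x̄_i` and `ȳ_i`. -/
theorem linearMap_ext_bar {M : Type*} [AddCommGroup M] [Module ℂ M] {f g : DoubledStd n →ₗ[ℂ] M}
    (hx : ∀ i, f (xbar i) = g (xbar i)) (hy : ∀ i, f (ybar i) = g (ybar i)) : f = g := by
  refine LinearMap.ext fun v => ?_
  rw [doubledStd_eq_sum v]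
  simp only [map_add, map_sum, map_smul, hx, hy]

/-- Alternating bilinear maps on `𝔥* ⊕ 𝔥` agree if they agree on the pairs of vectors `x̄_i`, `ȳ_j`
listed in the hypotheses. -/
theorem isAlt_ext_bar {M : Type*} [AddCommGroup M] [Module ℂ M]
    {f g : DoubledStd n →ₗ[ℂ] DoubledStd n →ₗ[ℂ] M} (hf : f.IsAlt) (hg : g.IsAlt)
    (hxx : ∀ i j, i ≠ j → f (xbar i) (xbar j) = g (xbar i) (xbar j))
    (hyy : ∀ i j, i ≠ j → f (ybar i) (ybar j) = g (ybar i) (ybar j))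
    (hxy : ∀ i j, f (xbar i) (ybar j) = g (xbar i) (ybar j)) : f = g := by
  refine linearMap_ext_bar (fun i => linearMap_ext_bar (fun j => ?_) fun j => hxy i j)
    fun i => linearMap_ext_bar (fun j => ?_) fun j => ?_
  · rcases eq_or_ne i j with rfl | h
    · rw [hf, hg]
    · exact hxx i j h
  · rw [← hf.neg, ← hg.neg, hxy]
  · rcases eq_or_ne i j with rfl | h
    · rw [hf, hg]
    · exact hyy i j h

end Basic

/-! ### Transpositions and 3-cycles -/

section Permutations

variable {n : ℕ}

/-- `g` is a 3-cycle. -/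
def IsCycle3 (g : Perm (Fin n)) : Prop :=
  ∃ p q r, p ≠ q ∧ q ≠ r ∧ p ≠ r ∧ g = cycle3 p q r

theorem cycle3_apply_left {p q r : Fin n} (hpq : p ≠ q) (hpr : p ≠ r) :
    cycle3 p q r p = q := by
  simp [cycle3, swap_apply_of_ne_of_ne hpq hpr]

theorem cycle3_apply_middle {p q r : Fin n} (hqr : q ≠ r) (hpr : p ≠ r) :
    cycle3 p q r q = r := by
  simp [cycle3, swap_apply_of_ne_of_ne hpr.symm hqr.symm]

theorem cycle3_apply_right (p q r : Fin n) : cycle3 p q r r = p := by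
  simp [cycle3]

theorem cycle3_apply_of_ne {p q r k : Fin n} (hp : k ≠ p) (hq : k ≠ q) (hr : k ≠ r) :
    cycle3 p q r k = k := by
  simp [cycle3, swap_apply_of_ne_of_ne, hp, hq, hr]

theorem cycle3_rotate {p q r : Fin n} (hpq : p ≠ q) (hqr : q ≠ r) (hpr : p ≠ r) :
    cycle3 p q r = cycle3 q r p := by
  ext1 k
  by_cases hp : k = p
  · subst hp; rw [cycle3_apply_left hpq hpr, cycle3_apply_right]
  by_cases hq : k = q
  · subst hq; rw [cycle3_apply_middle hqr hpr, cycle3_apply_left hqr hpq.symm]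
  by_cases hr : k = r
  · subst hr; rw [cycle3_apply_right, cycle3_apply_middle hpr.symm hpq.symm]
  rw [cycle3_apply_of_ne hp hq hr, cycle3_apply_of_ne hq hr hp]

theorem IsCycle3.not_isSwap {g : Perm (Fin n)} (hg : IsCycle3 g) : ¬ g.IsSwap := by
  obtain ⟨p, q, r, hpq, hqr, hpr, rfl⟩ := hg
  intro h
  have h1 := h.sign_eq
  simp [cycle3, Perm.sign_swap hpq, Perm.sign_swap hqr] at h1

theorem not_isSwap_one : ¬ (1 : Perm (Fin n)).IsSwap := fun h => by
  have h1 := h.sign_eq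
  simp at h1

theorem not_isCycle3_one : ¬ IsCycle3 (1 : Perm (Fin n)) := by
  rintro ⟨p, q, r, hpq, hqr, hpr, h⟩
  have := congrArg (fun g => g p) h
  simp only [Perm.one_apply, cycle3_apply_left hpq hpr] at this
  exact hpq this

theorem conj_swap (h : Perm (Fin n)) (p q : Fin n) :
    h * swap p q * h⁻¹ = swap (h p) (h q) := by
  rw [Equiv.swap_apply_apply]

theorem conj_cycle3 (h : Perm (Fin n)) (p q r : Fin n) :
    h * cycle3 p q r * h⁻¹ = cycle3 (h p) (h q) (h r) := by
  rw [cycle3, cycle3, ← conj_swap, ← conj_swap]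
  group

theorem isSwap_conj {g : Perm (Fin n)} (hg : g.IsSwap) (h : Perm (Fin n)) :
    (h * g * h⁻¹).IsSwap := by
  obtain ⟨p, q, hpq, rfl⟩ := hg
  exact ⟨h p, h q, h.injective.ne hpq, conj_swap h p q⟩

theorem isSwap_conj_iff {g : Perm (Fin n)} (h : Perm (Fin n)) :
    (h * g * h⁻¹).IsSwap ↔ g.IsSwap := by
  refine ⟨fun hg => ?_, fun hg => isSwap_conj hg h⟩
  have := isSwap_conj hg h⁻¹
  rwa [show h⁻¹ * (h * g * h⁻¹) * h⁻¹⁻¹ = g by group] at this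

theorem isCycle3_conj {g : Perm (Fin n)} (hg : IsCycle3 g) (h : Perm (Fin n)) :
    IsCycle3 (h * g * h⁻¹) := by
  obtain ⟨p, q, r, hpq, hqr, hpr, rfl⟩ := hg
  exact ⟨h p, h q, h r, h.injective.ne hpq, h.injective.ne hqr, h.injective.ne hpr,
    conj_cycle3 h p q r⟩

theorem isCycle3_conj_iff {g : Perm (Fin n)} (h : Perm (Fin n)) :
    IsCycle3 (h * g * h⁻¹) ↔ IsCycle3 g := by
  refine ⟨fun hg => ?_, fun hg => isCycle3_conj hg h⟩
  have := isCycle3_conj hg h⁻¹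
  rwa [show h⁻¹ * (h * g * h⁻¹) * h⁻¹⁻¹ = g by group] at this

/-- A 3-cycle that sends `i` to `j ≠ i` is `(i j k)` for some `k`. -/
theorem IsCycle3.eq_cycle3 {g : Perm (Fin n)} (hg : IsCycle3 g) {i j : Fin n} (hij : i ≠ j)
    (h : g i = j) : ∃ k, k ≠ i ∧ k ≠ j ∧ g = cycle3 i j k := by
  obtain ⟨p, q, r, hpq, hqr, hpr, rfl⟩ := hg
  by_cases hp : i = p
  · subst hp; rw [cycle3_apply_left hpq hpr] at h
    subst h; exact ⟨r, hpr.symm, hqr.symm, rfl⟩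
  by_cases hq : i = q
  · subst hq; rw [cycle3_apply_middle hqr hpr] at h
    subst h; exact ⟨p, hpq, hpr, cycle3_rotate hpq hqr hpr⟩
  by_cases hr : i = r
  · subst hr; rw [cycle3_apply_right] at h
    subst h
    exact ⟨q, hqr, hpq.symm, by rw [cycle3_rotate hpr.symm hpq hqr.symm]⟩
  rw [cycle3_apply_of_ne hp hq hr] at h
  exact absurd h hij

/-- The symmetric group is 2-transitive. -/
theorem exists_perm_map_pair {i j p q : Fin n} (hij : i ≠ j) (hpq : p ≠ q) :
    ∃ h : Perm (Fin n), h i = p ∧ h j = q := by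
  have h1 : swap i p j ≠ p := fun h => hij (by
    have := congrArg (swap i p) h
    simpa using this.symm)
  refine ⟨swap (swap i p j) q * swap i p, ?_, by simp⟩
  simp [swap_apply_of_ne_of_ne h1.symm hpq]

end Permutations

/-! ### The forms and vectors from which the family is built -/

section Forms

variable {n : ℕ}

/-- For a transposition `g = (p q)` this is the form
`⟨x_p - x_q, ·⟩ ∧ ⟨·, y_p - y_q⟩` on `𝔥* ⊕ 𝔥`. -/
def reflForm (g : Perm (Fin n)) : DoubledStd n →ₗ[ℂ] DoubledStd n →ₗ[ℂ] ℂ :=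
  -- Summing over all `k` avoids choosing an order of the two moved points; each of them gives the
  -- same summand, hence the factor `1/2`.
  LinearMap.mk₂ ℂ (fun v w => (1 / 2 : ℂ) *
      ∑ k, ((v.1.1 k - v.1.1 (g k)) * (w.2.1 k - w.2.1 (g k)) -
        (v.2.1 k - v.2.1 (g k)) * (w.1.1 k - w.1.1 (g k))))
    (fun u v w => by
      rw [← mul_add, ← Finset.sum_add_distrib]
      congr 1
      refine Finset.sum_congr rfl fun k _ => ?_
      simp; ring)
    (fun c v w => by
      rw [smul_eq_mul, mul_left_comm, Finset.mul_sum _ _ c]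
      congr 1
      refine Finset.sum_congr rfl fun k _ => ?_
      simp; ring)
    (fun u v w => by
      rw [← mul_add, ← Finset.sum_add_distrib]
      congr 1
      refine Finset.sum_congr rfl fun k _ => ?_
      simp; ring)
    (fun c v w => by
      rw [smul_eq_mul, mul_left_comm, Finset.mul_sum _ _ c]
      congr 1
      refine Finset.sum_congr rfl fun k _ => ?_
      simp; ring)

/-- The vector `b x - a y` of coordinates attached to `(x, y) ∈ 𝔥* ⊕ 𝔥`. -/
def mix (a b : ℂ) (v : DoubledStd n) (k : Fin n) : ℂ := b * v.1.1 k - a * v.2.1 k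

/-- The form `∑ k, (u_k w_{g k} - u_{g k} w_k)`, evaluated at the coordinate vectors
`u` and `w` that `mix a b` attaches to the two arguments. -/
def cycleForm (a b : ℂ) (g : Perm (Fin n)) : DoubledStd n →ₗ[ℂ] DoubledStd n →ₗ[ℂ] ℂ :=
  LinearMap.mk₂ ℂ (fun v w =>
      ∑ k, (mix a b v k * mix a b w (g k) - mix a b v (g k) * mix a b w k))
    (fun u v w => by
      rw [← Finset.sum_add_distrib]
      refine Finset.sum_congr rfl fun k _ => ?_
      simp [mix]; ring)
    (fun c v w => by
      rw [smul_eq_mul, Finset.mul_sum]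
      refine Finset.sum_congr rfl fun k _ => ?_
      simp [mix]; ring)
    (fun u v w => by
      rw [← Finset.sum_add_distrib]
      refine Finset.sum_congr rfl fun k _ => ?_
      simp [mix]; ring)
    (fun c v w => by
      rw [smul_eq_mul, Finset.mul_sum]
      refine Finset.sum_congr rfl fun k _ => ?_
      simp [mix]; ring)

theorem reflForm_apply (g : Perm (Fin n)) (v w : DoubledStd n) :
    reflForm g v w = (1 / 2 : ℂ) *
      ∑ k, ((v.1.1 k - v.1.1 (g k)) * (w.2.1 k - w.2.1 (g k)) -
        (v.2.1 k - v.2.1 (g k)) * (w.1.1 k - w.1.1 (g k))) := rfl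

theorem cycleForm_apply (a b : ℂ) (g : Perm (Fin n)) (v w : DoubledStd n) :
    cycleForm a b g v w =
      ∑ k, (mix a b v k * mix a b w (g k) - mix a b v (g k) * mix a b w k) := rfl

theorem reflForm_isAlt (g : Perm (Fin n)) : (reflForm g).IsAlt := fun v => by
  rw [reflForm_apply, Finset.sum_eq_zero, mul_zero]
  intros; ring

theorem cycleForm_isAlt (a b : ℂ) (g : Perm (Fin n)) : (cycleForm a b g).IsAlt := fun v => by
  rw [cycleForm_apply, Finset.sum_eq_zero]
  intros; ring

theorem reflForm_swap {p q : Fin n} (hpq : p ≠ q) (v w : DoubledStd n) :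
    reflForm (swap p q) v w = (v.1.1 p - v.1.1 q) * (w.2.1 p - w.2.1 q) -
      (v.2.1 p - v.2.1 q) * (w.1.1 p - w.1.1 q) := by
  rw [reflForm_apply, Finset.sum_eq_add p q hpq]
  · simp only [swap_apply_left, swap_apply_right]; ring
  · rintro k - ⟨hp, hq⟩
    rw [swap_apply_of_ne_of_ne hp hq]; ring
  · simp
  · simp

theorem cycleForm_cycle3 (a b : ℂ) {p q r : Fin n} (hpq : p ≠ q) (hqr : q ≠ r) (hpr : p ≠ r)
    (v w : DoubledStd n) :
    cycleForm a b (cycle3 p q r) v w =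
      (mix a b v p * mix a b w q - mix a b v q * mix a b w p) +
      (mix a b v q * mix a b w r - mix a b v r * mix a b w q) +
      (mix a b v r * mix a b w p - mix a b v p * mix a b w r) := by
  rw [cycleForm_apply, ← Finset.sum_subset (Finset.subset_univ {p, q, r})]
  · rw [Finset.sum_insert (by simp [hpq, hpr]), Finset.sum_insert (by simp [hqr]),
      Finset.sum_singleton, cycle3_apply_left hpq hpr, cycle3_apply_middle hqr hpr,
      cycle3_apply_right]
    ring
  · intro k _ hk
    simp only [Finset.mem_insert, Finset.mem_singleton, not_or] at hk
    rw [cycle3_apply_of_ne hk.1 hk.2.1 hk.2.2]; ring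

/-- The vector `∑_k (a x̄_k + b ȳ_k)`, the sum being over the points moved by `g`. -/
def moved (a b : ℂ) (g : Perm (Fin n)) : DoubledStd n :=
  ∑ k : Fin n with g k ≠ k, (a • xbar k + b • ybar k)

theorem moved_swap (a b : ℂ) {p q : Fin n} (hpq : p ≠ q) :
    moved a b (swap p q) = a • (xbar p + xbar q) + b • (ybar p + ybar q) := by
  have : (Finset.univ.filter fun k => swap p q k ≠ k) = {p, q} := by
    ext k
    simp only [Finset.mem_filter, Finset.mem_univ, true_and, Finset.mem_insert,
      Finset.mem_singleton]
    rw [swap_apply_ne_self_iff]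
    simp [hpq]
  rw [moved, this, Finset.sum_pair hpq]
  simp only [smul_add]
  abel

theorem moved_swap_fst (a b : ℂ) {p q : Fin n} (hpq : p ≠ q) (k : Fin n) :
    (moved a b (swap p q)).1.1 k =
      a * ((if k = p then 1 else 0) + (if k = q then 1 else 0) - 2 / (n : ℂ)) := by
  rw [moved_swap a b hpq]
  simp [xbar, ybar, bar_apply]; ring

theorem moved_swap_snd (a b : ℂ) {p q : Fin n} (hpq : p ≠ q) (k : Fin n) :
    (moved a b (swap p q)).2.1 k =
      b * ((if k = p then 1 else 0) + (if k = q then 1 else 0) - 2 / (n : ℂ)) := by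
  rw [moved_swap a b hpq]
  simp [xbar, ybar, bar_apply]; ring

/-- The two halves of a `moved` vector are `a` and `b` times one common vector, so `b x - a y`
cancels. Hence 3-cycle forms do not see the image of `κ^L`. -/
theorem mix_moved (a b : ℂ) {p q : Fin n} (hpq : p ≠ q) (k : Fin n) :
    mix a b (moved a b (swap p q)) k = 0 := by
  rw [mix, moved_swap_fst a b hpq, moved_swap_snd a b hpq]; ring

theorem cycleForm_moved (a b : ℂ) {p q : Fin n} (hpq : p ≠ q) (g : Perm (Fin n))
    (v : DoubledStd n) : cycleForm a b g v (moved a b (swap p q)) = 0 := by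
  rw [cycleForm_apply]
  simp [mix_moved a b hpq]

end Forms

/-! ### The explicit three-parameter family -/

section Family

variable {n : ℕ}

open Classical in
/-- The parameter map with parameters `a`, `b`, `c`. -/
def family (n : ℕ) (a b c : ℂ) : ParamMap (Perm (Fin n)) (DoubledStd n) where
  lin g := if g.IsSwap then
    (reflForm g).compr₂ (LinearMap.toSpanSingleton ℂ _ ((-((n : ℂ) / 2)) • moved a b g)) else 0
  const g := if g.IsSwap then c • reflForm g else
    if IsCycle3 g then ((n : ℂ) ^ 2 / 4) • cycleForm a b g else 0
  lin_alt g v := by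
    split_ifs
    · simp [reflForm_isAlt g v]
    · simp
  const_alt g v := by
    split_ifs
    · simp [reflForm_isAlt g v]
    · simp [cycleForm_isAlt a b g v]
    · simp

variable (a b c : ℂ)

theorem family_lin_of_isSwap {g : Perm (Fin n)} (hg : g.IsSwap) (v w : DoubledStd n) :
    (family n a b c).lin g v w = (-((n : ℂ) / 2) * reflForm g v w) • moved a b g := by
  simp [family, hg, smul_smul, mul_comm]

theorem family_lin_of_not_isSwap {g : Perm (Fin n)} (hg : ¬ g.IsSwap) :
    (family n a b c).lin g = 0 := by
  simp [family, hg]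

theorem family_const_of_isSwap {g : Perm (Fin n)} (hg : g.IsSwap) (v w : DoubledStd n) :
    (family n a b c).const g v w = c * reflForm g v w := by
  simp [family, hg]

theorem family_const_of_isCycle3 {g : Perm (Fin n)} (hg : IsCycle3 g) (v w : DoubledStd n) :
    (family n a b c).const g v w = (n : ℂ) ^ 2 / 4 * cycleForm a b g v w := by
  simp [family, hg, hg.not_isSwap]

theorem family_const_of_not {g : Perm (Fin n)} (hg : ¬ g.IsSwap) (hg' : ¬ IsCycle3 g) :
    (family n a b c).const g = 0 := by
  simp [family, hg, hg']

end Family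

/-! ### The defining conditions and the Cherednik relations single out the family -/

section Membership

variable {n : ℕ}

/-- Each of the two products sums to a Kronecker delta minus `1/n`; antisymmetrizing removes the
`1/n`. -/
theorem sum_bar_mul_bar (g : Perm (Fin n)) (i j : Fin n) :
    ∑ k, ((bar i).1 k * (bar j).1 (g k) - (bar i).1 (g k) * (bar j).1 k) =
      (if g i = j then 1 else 0) - (if g j = i then 1 else 0) := by
  have h1 : ∀ i j : Fin n, ∑ k, (bar i).1 k * (bar j).1 (g k) =
      (if g i = j then 1 else 0) - (1 / (n : ℂ)) := by
    intro i j
    have hj : ∑ k, (bar j).1 (g k) = 0 := (Equiv.sum_comp g (bar j).1).trans (bar j).2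
    have : ∀ k, (bar i).1 k * (bar j).1 (g k) =
        (if k = i then (bar j).1 (g k) else 0) - 1 / (n : ℂ) * (bar j).1 (g k) := by
      intro k
      rw [bar_apply i k]
      split_ifs <;> ring
    simp only [this, Finset.sum_sub_distrib, ← Finset.mul_sum, hj]
    simp [bar_apply]
  have h2 : ∑ k, (bar i).1 (g k) * (bar j).1 k = (if g j = i then 1 else 0) - (1 / (n : ℂ)) := by
    rw [← h1 j i]
    exact Finset.sum_congr rfl fun k _ => mul_comm _ _
  rw [Finset.sum_sub_distrib, h1, h2]
  ring

theorem mix_xbar (a b : ℂ) (i k : Fin n) : mix a b (xbar i) k = b * (bar i).1 k := by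
  simp [mix, xbar]

theorem mix_ybar (a b : ℂ) (i k : Fin n) : mix a b (ybar i) k = -a * (bar i).1 k := by
  simp [mix, ybar]

/-- The value of `cycleForm` at vectors whose mixed coordinates are multiples of `bar i` and
`bar j`. -/
theorem cycleForm_of_mix (a b s t : ℂ) (g : Perm (Fin n)) {v w : DoubledStd n} {i j : Fin n}
    (hv : ∀ k, mix a b v k = s * (bar i).1 k) (hw : ∀ k, mix a b w k = t * (bar j).1 k) :
    cycleForm a b g v w =
      s * t * ((if g i = j then 1 else 0) - (if g j = i then 1 else 0)) := by
  rw [cycleForm_apply, ← sum_bar_mul_bar, Finset.mul_sum]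
  refine Finset.sum_congr rfl fun k _ => ?_
  rw [hv, hv, hw, hw]
  ring

theorem reflForm_xbar_xbar (g : Perm (Fin n)) (i j : Fin n) :
    reflForm g (xbar i) (xbar j) = 0 := by
  simp [reflForm_apply, xbar]

theorem reflForm_ybar_ybar (g : Perm (Fin n)) (i j : Fin n) :
    reflForm g (ybar i) (ybar j) = 0 := by
  simp [reflForm_apply, ybar]

theorem reflForm_xbar_ybar {p q : Fin n} (hpq : p ≠ q) (i j : Fin n) :
    reflForm (swap p q) (xbar i) (ybar j) =
      ((if p = i then 1 else 0) - (if q = i then 1 else 0)) *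
      ((if p = j then 1 else 0) - (if q = j then 1 else 0)) := by
  simp [reflForm_swap hpq, xbar, ybar, bar_apply]

-- The index `k` is recovered from `(i j k)` as the image of `j`, so at most one summand is nonzero
-- at `g`.
open Classical in
theorem sum_single_cycle3 (z : ℂ) {i j : Fin n} (hij : i ≠ j) (g : Perm (Fin n)) :
    ∑ k : Fin n with k ≠ i ∧ k ≠ j,
      (Pi.single (cycle3 i j k) (0, z) : Perm (Fin n) → DoubledStd n × ℂ) g =
      if IsCycle3 g ∧ g i = j then (0, z) else 0 := by
  split_ifs with h
  · obtain ⟨k, hki, hkj, rfl⟩ := h.1.eq_cycle3 hij h.2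
    rw [Finset.sum_eq_single k, Pi.single_eq_same]
    · intro l hl hlk
      simp only [Finset.mem_filter, Finset.mem_univ, true_and] at hl
      refine Pi.single_eq_of_ne (fun heq => hlk ?_) _
      have := congrArg (fun g => g j) heq
      simp only [cycle3_apply_middle hkj.symm hki.symm,
        cycle3_apply_middle hl.2.symm hl.1.symm] at this
      exact this.symm
    · intro hk
      simp [hki, hkj] at hk
  · refine Finset.sum_eq_zero fun k hk => Pi.single_eq_of_ne (fun heq => h ?_) _
    simp only [Finset.mem_filter, Finset.mem_univ, true_and] at hk
    subst heq
    exact ⟨⟨i, j, k, hij, hk.2.symm, hk.1.symm, rfl⟩, cycle3_apply_left hij hk.1.symm⟩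

open Classical in
theorem cycleSum_apply (z : ℂ) {i j : Fin n} (hij : i ≠ j) (g : Perm (Fin n)) :
    cycleSum z i j g = if IsCycle3 g then
      (0, z * ((if g i = j then 1 else 0) - (if g j = i then 1 else 0))) else 0 := by
  have h2 : ∑ k : Fin n with k ≠ i ∧ k ≠ j,
      (Pi.single (cycle3 k j i) (0, z) : Perm (Fin n) → DoubledStd n × ℂ) g =
      ∑ k : Fin n with k ≠ j ∧ k ≠ i,
      (Pi.single (cycle3 j i k) (0, z) : Perm (Fin n) → DoubledStd n × ℂ) g := by
    refine Finset.sum_congr (Finset.filter_congr fun k _ => and_comm) fun k hk => ?_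
    simp only [Finset.mem_filter, Finset.mem_univ, true_and] at hk
    rw [cycle3_rotate hk.1 hij.symm hk.2]
  rw [cycleSum, Finset.sum_apply]
  simp only [Pi.sub_apply, Finset.sum_sub_distrib]
  rw [sum_single_cycle3 z hij, h2, sum_single_cycle3 z hij.symm]
  by_cases hg : IsCycle3 g <;> by_cases h1 : g i = j <;> by_cases h2 : g j = i <;>
    simp [hg, h1, h2] <;> rfl

theorem swapTerm_apply_self (a b c : ℂ) {i j : Fin n} (hij : i ≠ j) :
    swapTerm a b c i j (swap i j) = (((n : ℂ) / 2) • moved a b (swap i j), -c) := by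
  rw [swapTerm, Pi.single_eq_same, moved_swap a b hij]

theorem swapTerm_apply_of_ne (a b c : ℂ) {i j : Fin n} {g : Perm (Fin n)} (h : g ≠ swap i j) :
    swapTerm a b c i j g = 0 :=
  Pi.single_eq_of_ne h _

theorem family_val_swap (a b c : ℂ) {p q : Fin n} (hpq : p ≠ q) (v w : DoubledStd n) :
    (family n a b c).val v w (swap p q) =
      (-reflForm (swap p q) v w) • (((n : ℂ) / 2) • moved a b (swap p q), -c) := by
  have hg : (swap p q).IsSwap := ⟨p, q, hpq, rfl⟩
  rw [ParamMap.val, family_lin_of_isSwap _ _ _ hg, family_const_of_isSwap _ _ _ hg]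
  refine Prod.ext ?_ ?_
  · change _ = (-reflForm (swap p q) v w) • ((n : ℂ) / 2) • moved a b (swap p q)
    module
  · change _ = (-reflForm (swap p q) v w) * (-c)
    ring

theorem family_val_cycle3 (a b c : ℂ) {g : Perm (Fin n)} (hg : IsCycle3 g) (v w : DoubledStd n) :
    (family n a b c).val v w g = (0, (n : ℂ) ^ 2 / 4 * cycleForm a b g v w) := by
  rw [ParamMap.val, family_lin_of_not_isSwap _ _ _ hg.not_isSwap,
    family_const_of_isCycle3 _ _ _ hg]
  rfl

theorem family_val_of_not (a b c : ℂ) {g : Perm (Fin n)} (hg : ¬ g.IsSwap) (hg' : ¬ IsCycle3 g)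
    (v w : DoubledStd n) : (family n a b c).val v w g = 0 := by
  rw [ParamMap.val, family_lin_of_not_isSwap _ _ _ hg, family_const_of_not _ _ _ hg hg']
  rfl

theorem swap_eq_swap_iff_of_ne {p q i j : Fin n} (hpq : p ≠ q) :
    swap p q = swap i j ↔ (p = i ∧ q = j) ∨ (p = j ∧ q = i) := by
  constructor
  · intro h
    have h1 := congrArg (fun g => g p) h
    simp only [swap_apply_left] at h1
    by_cases hi : p = i
    · subst hi; rw [swap_apply_left] at h1; exact Or.inl ⟨rfl, h1⟩
    by_cases hj : p = j
    · subst hj; rw [swap_apply_right] at h1; exact Or.inr ⟨rfl, h1⟩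
    rw [swap_apply_of_ne_of_ne hi hj] at h1
    exact absurd h1.symm hpq
  · rintro (⟨rfl, rfl⟩ | ⟨rfl, rfl⟩)
    · rfl
    · exact swap_comm _ _

theorem family_inFamily (a b c : ℂ) : InFamily a b c (family n a b c) := by
  refine ⟨fun i j hij => ?_, fun i j hij => ?_, fun i => ?_, fun i j hij => ?_⟩ <;>
    funext g
  · rw [cycleSum_apply _ hij]
    by_cases hs : g.IsSwap
    · have hg := fun h : IsCycle3 g => h.not_isSwap hs
      obtain ⟨p, q, hpq, rfl⟩ := hs
      rw [family_val_swap _ _ _ hpq, reflForm_xbar_xbar, if_neg hg, neg_zero, zero_smul]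
    by_cases hg : IsCycle3 g
    · rw [family_val_cycle3 _ _ _ hg, if_pos hg,
        cycleForm_of_mix a b b b g (mix_xbar a b i) (mix_xbar a b j)]
      congr 1; ring
    · rw [family_val_of_not _ _ _ hs hg, if_neg hg]
  · rw [cycleSum_apply _ hij]
    by_cases hs : g.IsSwap
    · have hg := fun h : IsCycle3 g => h.not_isSwap hs
      obtain ⟨p, q, hpq, rfl⟩ := hs
      rw [family_val_swap _ _ _ hpq, reflForm_ybar_ybar, if_neg hg, neg_zero, zero_smul]
    by_cases hg : IsCycle3 g
    · rw [family_val_cycle3 _ _ _ hg, if_pos hg,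
        cycleForm_of_mix a b (-a) (-a) g (mix_ybar a b i) (mix_ybar a b j)]
      congr 1; ring
    · rw [family_val_of_not _ _ _ hs hg, if_neg hg]
  -- Only transpositions moving `i` contribute; writing them with `i` first makes `reflForm` equal
  -- to 1 and isolates the summand `k = q`.
  · have hswap : ∀ q, i ≠ q → (family n a b c).val (xbar i) (ybar i) (swap i q) =
        (-∑ k : Fin n with k ≠ i, swapTerm a b c i k) (swap i q) := by
      intro q hiq
      rw [family_val_swap _ _ _ hiq, reflForm_xbar_ybar hiq, Pi.neg_apply, Finset.sum_apply,
        Finset.sum_eq_single q, swapTerm_apply_self _ _ _ hiq]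
      · simp only [if_true, hiq.symm, if_false, sub_zero, mul_one]
        exact neg_one_smul ℂ (_ : DoubledStd n × ℂ)
      · intro k _ hkq
        refine swapTerm_apply_of_ne _ _ _ fun h => hkq ?_
        have := congrArg (fun g => g i) h
        simpa using this.symm
      · intro h
        simp [hiq.symm] at h
    by_cases hs : g.IsSwap
    · obtain ⟨p, q, hpq, rfl⟩ := hs
      by_cases hp : p = i
      · subst hp; exact hswap q hpq
      by_cases hq : q = i
      · subst hq; rw [swap_comm]; exact hswap p hpq.symm
      rw [family_val_swap _ _ _ hpq, reflForm_xbar_ybar hpq, Pi.neg_apply, Finset.sum_apply,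
        Finset.sum_eq_zero]
      · simp [hp, hq]
      · intro k _
        refine swapTerm_apply_of_ne _ _ _ fun h => ?_
        rw [swap_eq_swap_iff_of_ne hpq] at h
        tauto
    · have h0 : (-∑ k : Fin n with k ≠ i, swapTerm a b c i k) g = 0 := by
        rw [Pi.neg_apply, Finset.sum_apply, Finset.sum_eq_zero, neg_zero]
        intro k hk
        refine swapTerm_apply_of_ne _ _ _ fun h => hs ⟨i, k, ?_, h⟩
        simpa [eq_comm] using hk
      rw [h0]
      by_cases hg : IsCycle3 g
      · rw [family_val_cycle3 _ _ _ hg,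
          cycleForm_of_mix a b b (-a) g (mix_xbar a b i) (mix_ybar a b i)]
        simp
      · exact family_val_of_not _ _ _ hs hg _ _
  · rw [Pi.sub_apply, cycleSum_apply _ hij]
    by_cases hs : g.IsSwap
    · have hg := fun h : IsCycle3 g => h.not_isSwap hs
      obtain ⟨p, q, hpq, rfl⟩ := hs
      rw [family_val_swap _ _ _ hpq, reflForm_xbar_ybar hpq, if_neg hg, sub_zero]
      by_cases h : swap p q = swap i j
      · rw [h, swapTerm_apply_self _ _ _ hij]
        rcases (swap_eq_swap_iff_of_ne hpq).1 h with ⟨rfl, rfl⟩ | ⟨rfl, rfl⟩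
        · simp [hpq, hpq.symm]
        · simp [hpq, hpq.symm]
      · rw [swapTerm_apply_of_ne _ _ _ h]
        rw [swap_eq_swap_iff_of_ne hpq] at h
        by_cases h1 : p = i
        · subst h1
          have h2 : q ≠ j := fun h2 => h (Or.inl ⟨rfl, h2⟩)
          simp [hij, h2]
        · by_cases h2 : q = i
          · subst h2
            have h3 : p ≠ j := fun h3 => h (Or.inr ⟨h3, rfl⟩)
            simp [hij, h3]
          · simp [h1, h2]
    · rw [swapTerm_apply_of_ne _ _ _ fun h => hs ⟨i, j, hij, h⟩]
      by_cases hg : IsCycle3 g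
      · rw [family_val_cycle3 _ _ _ hg, if_pos hg,
          cycleForm_of_mix a b b (-a) g (mix_xbar a b i) (mix_ybar a b j), zero_sub, Prod.neg_mk,
          neg_zero]
        congr 1; ring
      · rw [family_val_of_not _ _ _ hs hg, if_neg hg, sub_zero]

/-- A parameter map is determined by its values on the vectors `x̄_i` and `ȳ_i`. -/
theorem paramMap_ext_bar {κ κ' : ParamMap (Perm (Fin n)) (DoubledStd n)}
    (hxx : ∀ i j, i ≠ j → κ.val (xbar i) (xbar j) = κ'.val (xbar i) (xbar j))
    (hyy : ∀ i j, i ≠ j → κ.val (ybar i) (ybar j) = κ'.val (ybar i) (ybar j))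
    (hxy : ∀ i j, κ.val (xbar i) (ybar j) = κ'.val (xbar i) (ybar j)) : κ = κ' := by
  refine ParamMap.ext (funext fun g => ?_) (funext fun g => ?_)
  · exact isAlt_ext_bar (κ.lin_alt g) (κ'.lin_alt g)
      (fun i j h => congrArg Prod.fst (congrFun (hxx i j h) g))
      (fun i j h => congrArg Prod.fst (congrFun (hyy i j h) g))
      (fun i j => congrArg Prod.fst (congrFun (hxy i j) g))
  · exact isAlt_ext_bar (κ.const_alt g) (κ'.const_alt g)
      (fun i j h => congrArg Prod.snd (congrFun (hxx i j h) g))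
      (fun i j h => congrArg Prod.snd (congrFun (hyy i j h) g))
      (fun i j => congrArg Prod.snd (congrFun (hxy i j) g))

theorem inFamily_iff (a b c : ℂ) (κ : ParamMap (Perm (Fin n)) (DoubledStd n)) :
    InFamily a b c κ ↔ κ = family n a b c := by
  refine ⟨fun h => ?_, fun h => h ▸ family_inFamily a b c⟩
  have h' := family_inFamily (n := n) a b c
  refine paramMap_ext_bar (fun i j hij => (h.xx i j hij).trans (h'.xx i j hij).symm)
    (fun i j hij => (h.yy i j hij).trans (h'.yy i j hij).symm) fun i j => ?_
  rcases eq_or_ne i j with rfl | hij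
  · exact (h.xy_same i).trans (h'.xy_same i).symm
  · exact (h.xy i j hij).trans (h'.xy i j hij).symm

theorem sum_single_swap_apply (F : Fin n → Fin n → DoubledStd n × ℂ) {p q : Fin n} (hpq : p < q) :
    (∑ r : Fin n × Fin n with r.1 < r.2, Pi.single (swap r.1 r.2) (F r.1 r.2) :
      Perm (Fin n) → DoubledStd n × ℂ) (swap p q) = F p q := by
  rw [Finset.sum_apply, Finset.sum_eq_single (p, q), Pi.single_eq_same]
  · rintro ⟨i, j⟩ hr hne
    simp only [Finset.mem_filter, Finset.mem_univ, true_and] at hr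
    refine Pi.single_eq_of_ne (fun h => ?_) _
    rcases (swap_eq_swap_iff_of_ne hpq.ne).1 h with ⟨rfl, rfl⟩ | ⟨rfl, rfl⟩
    · exact hne rfl
    · exact lt_asymm hpq hr
  · intro h
    simp [hpq] at h

theorem family_zero_isCherednikMap (c : ℂ) : IsCherednikMap c (family n 0 0 c) := by
  have hc : ∀ (g : Perm (Fin n)) (v w : DoubledStd n), cycleForm 0 0 g v w = 0 := fun g v w => by
    simp [cycleForm_apply, mix]
  have hm : ∀ g : Perm (Fin n), moved 0 0 g = 0 := fun g => by simp [moved]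
  refine ⟨fun x x' => funext fun g => ?_, fun y y' => funext fun g => ?_,
    fun x y => funext fun g => ?_⟩
  · by_cases hs : g.IsSwap
    · obtain ⟨p, q, hpq, rfl⟩ := hs
      rw [family_val_swap _ _ _ hpq, reflForm_swap hpq]
      simp
    by_cases hg : IsCycle3 g
    · rw [family_val_cycle3 _ _ _ hg, hc]
      simp
    · exact family_val_of_not _ _ _ hs hg _ _
  · by_cases hs : g.IsSwap
    · obtain ⟨p, q, hpq, rfl⟩ := hs
      rw [family_val_swap _ _ _ hpq, reflForm_swap hpq]
      simp
    by_cases hg : IsCycle3 g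
    · rw [family_val_cycle3 _ _ _ hg, hc]
      simp
    · exact family_val_of_not _ _ _ hs hg _ _
  · by_cases hs : g.IsSwap
    · have key : ∀ p q : Fin n, p < q → (family n 0 0 c).val (x, 0) (0, y) (swap p q) =
          (∑ p : Fin n × Fin n with p.1 < p.2, Pi.single (swap p.1 p.2)
            (0, c * ((y.1 p.1 - y.1 p.2) * (x.1 p.1 - x.1 p.2))) :
              Perm (Fin n) → DoubledStd n × ℂ) (swap p q) := by
        intro p q hpq
        rw [sum_single_swap_apply
          (fun p q => (0, c * ((y.1 p - y.1 q) * (x.1 p - x.1 q)))) hpq,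
          family_val_swap _ _ _ hpq.ne, reflForm_swap hpq.ne, hm]
        simp
        ring
      obtain ⟨p, q, hpq, rfl⟩ := hs
      rcases lt_or_gt_of_ne hpq with h | h
      · exact key p q h
      · rw [swap_comm]; exact key q p h
    · have h0 : (∑ p : Fin n × Fin n with p.1 < p.2, Pi.single (swap p.1 p.2)
            (0, c * ((y.1 p.1 - y.1 p.2) * (x.1 p.1 - x.1 p.2))) :
              Perm (Fin n) → DoubledStd n × ℂ) g = 0 := by
        rw [Finset.sum_apply, Finset.sum_eq_zero]
        rintro ⟨p, q⟩ hr
        simp only [Finset.mem_filter, Finset.mem_univ, true_and] at hr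
        exact Pi.single_eq_of_ne (fun h => hs ⟨p, q, hr.ne, h⟩) _
      rw [h0]
      by_cases hg : IsCycle3 g
      · rw [family_val_cycle3 _ _ _ hg, hc]
        simp
      · exact family_val_of_not _ _ _ hs hg _ _

theorem inFamily_zero_iff (c : ℂ) (κ : ParamMap (Perm (Fin n)) (DoubledStd n)) :
    InFamily 0 0 c κ ↔ IsCherednikMap c κ := by
  rw [inFamily_iff]
  refine ⟨fun h => h ▸ family_zero_isCherednikMap c, fun h => ?_⟩
  have h' := family_zero_isCherednikMap (n := n) c
  exact paramMap_ext_bar (fun i j _ => (h.xx _ _).trans (h'.xx _ _).symm)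
    (fun i j _ => (h.yy _ _).trans (h'.yy _ _).symm)
    fun i j => (h.xy _ _).trans (h'.xy _ _).symm

end Membership

/-! ### Exterior identities behind the obstructions -/

section Conditions

variable {n : ℕ}

/-- With `α = x_p - x_q` and `β = y_p - y_q` as functionals, `reflForm` is `α ∧ β` and the
coordinates of `(p q) u - u` are multiples of `α(u)` or `β(u)`. The cyclic sum is therefore `α ∧ β ∧
α` or `α ∧ β ∧ β`. -/
theorem cyclicSum_reflForm_smul {p q : Fin n} (hpq : p ≠ q) (v₁ v₂ v₃ : DoubledStd n) :
    cyclicSum (fun u v w => reflForm (swap p q) v w • (doubledStdRep n (swap p q) u - u))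
      v₁ v₂ v₃ = 0 := by
  simp only [cyclicSum, reflForm_swap hpq]
  refine doubledStd_ext (fun k => ?_) fun k => ?_ <;>
  · by_cases hp : k = p
    · subst hp; simp; ring
    by_cases hq : k = q
    · subst hq; simp; ring
    simp [swap_apply_of_ne_of_ne hp hq]

theorem reflForm_moved (a b : ℂ) {p q r s : Fin n} (hpq : p ≠ q) (hrs : r ≠ s)
    (v : DoubledStd n) :
    reflForm (swap p q) v (moved a b (swap r s)) = (mix a b v p - mix a b v q) *
      (((if p = r then 1 else 0) + (if p = s then 1 else 0)) -
        ((if q = r then 1 else 0) + (if q = s then 1 else 0))) := by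
  simp only [reflForm_swap hpq, moved_swap_fst a b hrs, moved_swap_snd a b hrs, mix]
  ring

/-- The last factor in `reflForm_moved` vanishes when the two pairs coincide or are disjoint; pairs
sharing exactly one point multiply to a 3-cycle. -/
theorem isCycle3_of_reflForm_moved_ne_zero (a b : ℂ) {x y : Perm (Fin n)} (hx : x.IsSwap)
    (hy : y.IsSwap) {v : DoubledStd n} (h : reflForm x v (moved a b y) ≠ 0) :
    IsCycle3 (x * y) := by
  obtain ⟨p, q, hpq, rfl⟩ := hx
  obtain ⟨r, s, hrs, rfl⟩ := hy
  rw [reflForm_moved a b hpq hrs] at h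
  replace h := right_ne_zero_of_mul h
  by_cases h1 : p = r
  · subst h1
    have hqs : q ≠ s := by rintro rfl; simp [hpq, hpq.symm] at h
    exact ⟨q, p, s, hpq.symm, hrs, hqs, by rw [cycle3, swap_comm p q]⟩
  by_cases h2 : p = s
  · subst h2
    have hqr : q ≠ r := by rintro rfl; simp [hpq, hpq.symm] at h
    exact ⟨q, p, r, hpq.symm, hrs.symm, hqr, by rw [cycle3, swap_comm p q, swap_comm r p]⟩
  by_cases h3 : q = r
  · subst h3
    exact ⟨p, q, s, hpq, hrs, h2, rfl⟩
  by_cases h4 : q = s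
  · subst h4
    exact ⟨p, q, r, hpq, hrs.symm, h1, by rw [cycle3, swap_comm r q]⟩
  simp [h1, h2, h3, h4] at h

theorem swap_inv_mul_cycle3 (p q r : Fin n) : (swap p q)⁻¹ * cycle3 p q r = swap q r := by
  rw [cycle3, inv_mul_cancel_left]

/-- The factorizations of a 3-cycle into two transpositions. -/
theorem eq_of_isSwap_of_isSwap {p q r : Fin n} (hpq : p ≠ q) (hqr : q ≠ r) (hpr : p ≠ r)
    {x : Perm (Fin n)} (hx : x.IsSwap) (hy : (x⁻¹ * cycle3 p q r).IsSwap) :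
    x = swap p q ∨ x = swap q r ∨ x = swap r p := by
  -- If `x = (s t)` with `s` outside `{p, q, r}`, the other factor sends `s` to `t`, so it is also
  -- `(s t)` and the 3-cycle would be trivial.
  have key : ∀ s t : Fin n, s ≠ t → x = swap s t → s = p ∨ s = q ∨ s = r := by
    intro s t hst hx
    by_contra! hs
    have h1 : (x⁻¹ * cycle3 p q r) s = t := by
      rw [Perm.mul_apply, cycle3_apply_of_ne hs.1 hs.2.1 hs.2.2, hx, swap_inv, swap_apply_left]
    obtain ⟨i, j, hij, h⟩ := hy
    have h2 : swap i j = swap s t := by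
      rw [h] at h1
      rw [swap_eq_swap_iff_of_ne hij]
      by_cases hi : s = i
      · subst hi; rw [swap_apply_left] at h1; exact Or.inl ⟨rfl, h1⟩
      by_cases hj : s = j
      · subst hj; rw [swap_apply_right] at h1; exact Or.inr ⟨h1, rfl⟩
      rw [swap_apply_of_ne_of_ne hi hj] at h1
      exact absurd h1 hst
    have h3 : cycle3 p q r = 1 := by
      rw [h2, hx, swap_inv] at h
      exact mul_eq_left.1 h
    exact not_isCycle3_one ⟨p, q, r, hpq, hqr, hpr, h3.symm⟩
  obtain ⟨s, t, hst, rfl⟩ := hx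
  have hs := key s t hst rfl
  have ht := key t s hst.symm (swap_comm s t)
  rcases hs with rfl | rfl | rfl <;> rcases ht with rfl | rfl | rfl <;>
    simp_all [swap_comm]

theorem sum_eq_of_cycle3 {M : Type*} [AddCommMonoid M] {p q r : Fin n} (hpq : p ≠ q) (hqr : q ≠ r)
    (hpr : p ≠ r) {F : Perm (Fin n) → Perm (Fin n) → M}
    (hF : ∀ x y, ¬ (x.IsSwap ∧ y.IsSwap) → F x y = 0) :
    ∑ x, F x (x⁻¹ * cycle3 p q r) =
      F (swap p q) (swap q r) + F (swap q r) (swap r p) + F (swap r p) (swap p q) := by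
  have h1 : swap p q ≠ swap q r := by
    rw [Ne, swap_eq_swap_iff_of_ne hpq]; rintro (h | h) <;> simp_all
  have h2 : swap p q ≠ swap r p := by
    rw [Ne, swap_eq_swap_iff_of_ne hpq]; rintro (h | h) <;> simp_all
  have h3 : swap q r ≠ swap r p := by
    rw [Ne, swap_eq_swap_iff_of_ne hqr]; rintro (h | h) <;> simp_all
  rw [← Finset.sum_subset (Finset.subset_univ {swap p q, swap q r, swap r p})]
  · rw [Finset.sum_insert (by simp [h1, h2]), Finset.sum_insert (by simp [h3]),
      Finset.sum_singleton, swap_inv_mul_cycle3, cycle3_rotate hpq hqr hpr, swap_inv_mul_cycle3,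
      cycle3_rotate hqr hpr.symm hpq.symm, swap_inv_mul_cycle3, add_assoc]
  · intro x _ hx
    refine hF _ _ fun h => hx ?_
    simpa using eq_of_isSwap_of_isSwap hpq hqr hpr h.1 h.2

variable (a b c : ℂ)

/-- The scalar `κ_x(u + y u, κ_y(v, w))` up to normalization, for transpositions `x` and `y`. -/
def composite (x y : Perm (Fin n)) (u v w : DoubledStd n) : ℂ :=
  reflForm x (u + doubledStdRep n y u) (moved a b y) * reflForm y v w

theorem composite_swap {p q r : Fin n} (hpq : p ≠ q) (hqr : q ≠ r) (hpr : p ≠ r)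
    (u v w : DoubledStd n) :
    composite a b (swap p q) (swap q r) u v w =
      (mix a b u q + mix a b u r - 2 * mix a b u p) * reflForm (swap q r) v w := by
  rw [composite, reflForm_moved a b hpq hqr]
  simp [mix, hpq, hpr, hqr, swap_apply_of_ne_of_ne hpq hpr]
  left; ring

/-- Let `X₁, X₂, X₃` be the differences `x_q - x_r`, `x_r - x_p`, `x_p - x_q`, similarly `Y` and `M
= b X - a Y`. The sum is that of `(M₂ - M₃) ∧ X₁ ∧ Y₁` and its rotations. As the `X` add up to zero,
its `b`-part collapses to `2 X₂ ∧ X₁ ∧ (Y₁ + Y₂ + Y₃) = 0`; the `a`-part is analogous. -/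
theorem cyclicSum_composite {p q r : Fin n} (hpq : p ≠ q) (hqr : q ≠ r) (hpr : p ≠ r)
    (v₁ v₂ v₃ : DoubledStd n) :
    cyclicSum (fun u v w => composite a b (swap p q) (swap q r) u v w +
      composite a b (swap q r) (swap r p) u v w + composite a b (swap r p) (swap p q) u v w)
      v₁ v₂ v₃ = 0 := by
  simp only [cyclicSum, composite_swap a b hpq hqr hpr, composite_swap a b hqr hpr.symm hpq.symm,
    composite_swap a b hpr.symm hpq hqr.symm, reflForm_swap hpq, reflForm_swap hqr,
    reflForm_swap hpr.symm, mix]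
  ring

/-- In the same notation `cycleForm` is `M₁ ∧ M₂`, and wedging with `X₂` retains only the `-a Y₂` in
`M₂`. On the left `M₃ - M₁ = -2 M₁ - M₂`, and `M₂` dies against `X₂ ∧ Y₂`. Both sides are `-2a M₁ ∧
X₂ ∧ Y₂`. -/
theorem cyclicSum_composite_fst {p q r : Fin n} (hpq : p ≠ q) (hqr : q ≠ r) (hpr : p ≠ r)
    (v₁ v₂ v₃ : DoubledStd n) :
    a * cyclicSum (composite a b (swap q r) (swap r p)) v₁ v₂ v₃ =
      -2 * cyclicSum (fun u v w => cycleForm a b (cycle3 p q r) v w * (u.1.1 r - u.1.1 p))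
        v₁ v₂ v₃ := by
  simp only [cyclicSum, composite_swap a b hqr hpr.symm hpq.symm,
    reflForm_swap hpr.symm, cycleForm_cycle3 a b hpq hqr hpr, mix]
  ring

theorem cyclicSum_composite_snd {p q r : Fin n} (hpq : p ≠ q) (hqr : q ≠ r) (hpr : p ≠ r)
    (v₁ v₂ v₃ : DoubledStd n) :
    b * cyclicSum (composite a b (swap q r) (swap r p)) v₁ v₂ v₃ =
      -2 * cyclicSum (fun u v w => cycleForm a b (cycle3 p q r) v w * (u.2.1 r - u.2.1 p))
        v₁ v₂ v₃ := by
  simp only [cyclicSum, composite_swap a b hqr hpr.symm hpq.symm,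
    reflForm_swap hpr.symm, cycleForm_cycle3 a b hpq hqr hpr, mix]
  ring

end Conditions

/-! ### The family consists of Drinfeld orbifold algebra maps -/

section FamilyIsMap

variable {n : ℕ} (a b c : ℂ)

theorem family_lin_comp {x y : Perm (Fin n)} (u v w : DoubledStd n) (hx : x.IsSwap)
    (hy : y.IsSwap) :
    (family n a b c).lin x (u + doubledStdRep n y u) ((family n a b c).lin y v w) =
      ((n : ℂ) ^ 2 / 4 * composite a b x y u v w) • moved a b x := by
  rw [family_lin_of_isSwap _ _ _ hx, family_lin_of_isSwap _ _ _ hy, composite, map_smul,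
    smul_eq_mul]
  congr 1; ring

theorem family_const_comp {x y : Perm (Fin n)} (u v w : DoubledStd n) (hx : x.IsSwap)
    (hy : y.IsSwap) :
    (family n a b c).const x (u + doubledStdRep n y u) ((family n a b c).lin y v w) =
      -(c * (n : ℂ) / 2) * composite a b x y u v w := by
  rw [family_const_of_isSwap _ _ _ hx, family_lin_of_isSwap _ _ _ hy, composite, map_smul,
    smul_eq_mul]
  ring

theorem family_lin_comp_of_not {x y : Perm (Fin n)} (u v w : DoubledStd n)
    (h : ¬ (x.IsSwap ∧ y.IsSwap)) :
    (family n a b c).lin x (u + doubledStdRep n y u) ((family n a b c).lin y v w) = 0 := by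
  by_cases hx : x.IsSwap
  · rw [family_lin_of_not_isSwap _ _ _ fun hy => h ⟨hx, hy⟩]
    simp
  · rw [family_lin_of_not_isSwap _ _ _ hx]
    rfl

/-- The case not settled by supports is a 3-cycle `x` with a transposition `y`; there `cycleForm`
annihilates the `moved` vector. -/
theorem family_const_comp_of_not {x y : Perm (Fin n)} (u v w : DoubledStd n)
    (h : ¬ (x.IsSwap ∧ y.IsSwap)) :
    (family n a b c).const x (u + doubledStdRep n y u) ((family n a b c).lin y v w) = 0 := by
  by_cases hy : y.IsSwap
  · have hx : ¬ x.IsSwap := fun hx => h ⟨hx, hy⟩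
    by_cases hx' : IsCycle3 x
    · rw [family_const_of_isCycle3 _ _ _ hx', family_lin_of_isSwap _ _ _ hy, map_smul]
      obtain ⟨p, q, hpq, rfl⟩ := hy
      rw [cycleForm_moved a b hpq]
      simp
    · rw [family_const_of_not _ _ _ hx hx']
      rfl
  · rw [family_lin_of_not_isSwap _ _ _ hy]
    simp

theorem composite_eq_zero {x y : Perm (Fin n)} (u v w : DoubledStd n) (hx : x.IsSwap)
    (hy : y.IsSwap) (h : ¬ IsCycle3 (x * y)) : composite a b x y u v w = 0 := by
  rw [composite]
  by_contra h0
  exact h (isCycle3_of_reflForm_moved_ne_zero a b hx hy (left_ne_zero_of_mul h0))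

theorem family_lin_comp_eq_zero {g x : Perm (Fin n)} (u v w : DoubledStd n)
    (hg : ¬ IsCycle3 g) :
    (family n a b c).lin x (u + doubledStdRep n (x⁻¹ * g) u)
      ((family n a b c).lin (x⁻¹ * g) v w) = 0 := by
  by_cases h : x.IsSwap ∧ (x⁻¹ * g).IsSwap
  · rw [family_lin_comp a b c u v w h.1 h.2,
      composite_eq_zero a b u v w h.1 h.2 (by rwa [mul_inv_cancel_left]), mul_zero, zero_smul]
  · exact family_lin_comp_of_not a b c u v w h

theorem family_const_comp_eq_zero {g x : Perm (Fin n)} (u v w : DoubledStd n)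
    (hg : ¬ IsCycle3 g) :
    (family n a b c).const x (u + doubledStdRep n (x⁻¹ * g) u)
      ((family n a b c).lin (x⁻¹ * g) v w) = 0 := by
  by_cases h : x.IsSwap ∧ (x⁻¹ * g).IsSwap
  · rw [family_const_comp a b c u v w h.1 h.2,
      composite_eq_zero a b u v w h.1 h.2 (by rwa [mul_inv_cancel_left]), mul_zero]
  · exact family_const_comp_of_not a b c u v w h

theorem sum_family_lin_comp {p q r : Fin n} (hpq : p ≠ q) (hqr : q ≠ r) (hpr : p ≠ r)
    (u v w : DoubledStd n) :
    ∑ x, (family n a b c).lin x (u + doubledStdRep n (x⁻¹ * cycle3 p q r) u)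
      ((family n a b c).lin (x⁻¹ * cycle3 p q r) v w) =
    ((n : ℂ) ^ 2 / 4) • (composite a b (swap p q) (swap q r) u v w • moved a b (swap p q) +
      composite a b (swap q r) (swap r p) u v w • moved a b (swap q r) +
      composite a b (swap r p) (swap p q) u v w • moved a b (swap r p)) := by
  rw [sum_eq_of_cycle3 hpq hqr hpr (F := fun x y =>
    (family n a b c).lin x (u + doubledStdRep n y u) ((family n a b c).lin y v w))
    fun x y => family_lin_comp_of_not a b c u v w]
  have h1 : (swap p q).IsSwap := ⟨p, q, hpq, rfl⟩
  have h2 : (swap q r).IsSwap := ⟨q, r, hqr, rfl⟩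
  have h3 : (swap r p).IsSwap := ⟨r, p, hpr.symm, rfl⟩
  rw [family_lin_comp a b c u v w h1 h2, family_lin_comp a b c u v w h2 h3,
    family_lin_comp a b c u v w h3 h1]
  module

theorem sum_family_const_comp {p q r : Fin n} (hpq : p ≠ q) (hqr : q ≠ r) (hpr : p ≠ r)
    (u v w : DoubledStd n) :
    ∑ x, (family n a b c).const x (u + doubledStdRep n (x⁻¹ * cycle3 p q r) u)
      ((family n a b c).lin (x⁻¹ * cycle3 p q r) v w) =
    -(c * (n : ℂ) / 2) * (composite a b (swap p q) (swap q r) u v w +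
      composite a b (swap q r) (swap r p) u v w + composite a b (swap r p) (swap p q) u v w) := by
  rw [sum_eq_of_cycle3 hpq hqr hpr (F := fun x y =>
    (family n a b c).const x (u + doubledStdRep n y u) ((family n a b c).lin y v w))
    fun x y => family_const_comp_of_not a b c u v w]
  have h1 : (swap p q).IsSwap := ⟨p, q, hpq, rfl⟩
  have h2 : (swap q r).IsSwap := ⟨q, r, hqr, rfl⟩
  have h3 : (swap r p).IsSwap := ⟨r, p, hpr.symm, rfl⟩
  rw [family_const_comp a b c u v w h1 h2, family_const_comp a b c u v w h2 h3,
    family_const_comp a b c u v w h3 h1]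
  ring

theorem family_first_obstruction_cycle3 {p q r : Fin n} (hpq : p ≠ q) (hqr : q ≠ r) (hpr : p ≠ r)
    (v₁ v₂ v₃ : DoubledStd n) :
    cyclicSum (fun u v w => composite a b (swap p q) (swap q r) u v w • moved a b (swap p q) +
      composite a b (swap q r) (swap r p) u v w • moved a b (swap q r) +
      composite a b (swap r p) (swap p q) u v w • moved a b (swap r p)) v₁ v₂ v₃ =
    (2 : ℂ) • cyclicSum (fun u v w => cycleForm a b (cycle3 p q r) v w •
      (doubledStdRep n (cycle3 p q r) u - u)) v₁ v₂ v₃ := by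
  have hsymm : ∀ k l, cycle3 p q r k = l → (cycle3 p q r).symm l = k := fun k l h =>
    (Equiv.symm_apply_eq _).2 h.symm
  have hp := hsymm r p (cycle3_apply_right p q r)
  have hq := hsymm p q (cycle3_apply_left hpq hpr)
  have hr := hsymm q r (cycle3_apply_middle hqr hpr)
  have h0 := cyclicSum_composite a b hpq hqr hpr v₁ v₂ v₃
  have rot1 := cycle3_rotate hpq hqr hpr
  have rot2 := cycle3_rotate hqr hpr.symm hpq.symm
  refine doubledStd_ext (fun k => ?_) fun k => ?_
  · have e1 := cyclicSum_composite_fst a b hpq hqr hpr v₁ v₂ v₃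
    have e2 := cyclicSum_composite_fst a b hqr hpr.symm hpq.symm v₁ v₂ v₃
    have e3 := cyclicSum_composite_fst a b hpr.symm hpq hqr.symm v₁ v₂ v₃
    rw [← rot1] at e2
    rw [← rot2, ← rot1] at e3
    simp only [cyclicSum] at h0 e1 e2 e3 ⊢
    simp only [Prod.fst_add, Prod.smul_fst, Prod.fst_sub, Submodule.coe_add, Submodule.coe_sub,
      SetLike.val_smul, Pi.add_apply, Pi.sub_apply, Pi.smul_apply, smul_eq_mul,
      moved_swap_fst a b hpq, moved_swap_fst a b hqr, moved_swap_fst a b hpr.symm,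
      doubledStdRep_fst_apply]
    by_cases h1 : k = p
    · subst h1
      simp only [hp, if_true, hpq, hpr, if_false]
      -- At a point of the cycle, two of the three `moved` vectors have coordinate `a - 2a/n` and
      -- the third, whose transposition fixes the point, has `-2a/n`. Completing the third costs the
      -- correction `e1`.
      linear_combination (a - 2 * a / n) * h0 - e1
    by_cases h2 : k = q
    · subst h2
      simp only [hq, if_true, hpq.symm, hqr, if_false]
      linear_combination (a - 2 * a / n) * h0 - e2
    by_cases h3 : k = r
    · subst h3
      simp only [hr, if_true, hpr.symm, hqr.symm, if_false]
      linear_combination (a - 2 * a / n) * h0 - e3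
    rw [hsymm k k (cycle3_apply_of_ne h1 h2 h3)]
    simp only [h1, h2, h3, if_false]
    linear_combination (-2 * a / n) * h0
  · have e1 := cyclicSum_composite_snd a b hpq hqr hpr v₁ v₂ v₃
    have e2 := cyclicSum_composite_snd a b hqr hpr.symm hpq.symm v₁ v₂ v₃
    have e3 := cyclicSum_composite_snd a b hpr.symm hpq hqr.symm v₁ v₂ v₃
    rw [← rot1] at e2
    rw [← rot2, ← rot1] at e3
    simp only [cyclicSum] at h0 e1 e2 e3 ⊢
    simp only [Prod.snd_add, Prod.smul_snd, Prod.snd_sub, Submodule.coe_add, Submodule.coe_sub,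
      SetLike.val_smul, Pi.add_apply, Pi.sub_apply, Pi.smul_apply, smul_eq_mul,
      moved_swap_snd a b hpq, moved_swap_snd a b hqr, moved_swap_snd a b hpr.symm,
      doubledStdRep_snd_apply]
    by_cases h1 : k = p
    · subst h1
      simp only [hp, if_true, hpq, hpr, if_false]
      linear_combination (b - 2 * b / n) * h0 - e1
    by_cases h2 : k = q
    · subst h2
      simp only [hq, if_true, hpq.symm, hqr, if_false]
      linear_combination (b - 2 * b / n) * h0 - e2
    by_cases h3 : k = r
    · subst h3
      simp only [hr, if_true, hpr.symm, hqr.symm, if_false]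
      linear_combination (b - 2 * b / n) * h0 - e3
    rw [hsymm k k (cycle3_apply_of_ne h1 h2 h3)]
    simp only [h1, h2, h3, if_false]
    linear_combination (-2 * b / n) * h0

theorem cyclicSum_smul {V M : Type*} [AddCommGroup M] [Module ℂ M] (z : ℂ) (F : V → V → V → M)
    (v₁ v₂ v₃ : V) : cyclicSum (fun u v w => z • F u v w) v₁ v₂ v₃ = z • cyclicSum F v₁ v₂ v₃ := by
  simp only [cyclicSum, smul_add]

theorem cyclicSum_zero {V M : Type*} [AddCommMonoid M] (v₁ v₂ v₃ : V) :
    cyclicSum (fun _ _ _ => (0 : M)) v₁ v₂ v₃ = 0 := by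
  simp [cyclicSum]

theorem doubledStdRep_moved (h : Perm (Fin n)) {p q : Fin n} (hpq : p ≠ q) :
    doubledStdRep n h (moved a b (swap p q)) = moved a b (swap (h p) (h q)) := by
  rw [moved_swap a b hpq, moved_swap a b (h.injective.ne hpq)]
  simp only [map_add, map_smul, doubledStdRep_xbar, doubledStdRep_ybar]

theorem reflForm_doubledStdRep_inv (h : Perm (Fin n)) {p q : Fin n} (hpq : p ≠ q)
    (v w : DoubledStd n) :
    reflForm (swap p q) (doubledStdRep n h⁻¹ v) (doubledStdRep n h⁻¹ w) =
      reflForm (swap (h p) (h q)) v w := by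
  rw [reflForm_swap hpq, reflForm_swap (h.injective.ne hpq)]
  rfl

/-- The members of the three-parameter family are Drinfeld orbifold algebra maps. -/
theorem family_isDrinfeldOrbifoldAlgebraMap :
    IsDrinfeldOrbifoldAlgebraMap (doubledStdRep n) (family n a b c) where
  image_fixed g v w := by
    by_cases hg : g.IsSwap
    · rw [family_lin_of_isSwap _ _ _ hg, map_smul]
      obtain ⟨p, q, hpq, rfl⟩ := hg
      rw [doubledStdRep_moved a b _ hpq, swap_apply_left, swap_apply_right, swap_comm]
    · rw [family_lin_of_not_isSwap _ _ _ hg]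
      simp
  lin_invariant g h v w := by
    by_cases hg : g.IsSwap
    · rw [family_lin_of_isSwap _ _ _ hg, family_lin_of_isSwap _ _ _ (isSwap_conj hg h), map_smul]
      obtain ⟨p, q, hpq, rfl⟩ := hg
      rw [doubledStdRep_moved a b _ hpq, reflForm_doubledStdRep_inv h hpq, conj_swap]
    · rw [family_lin_of_not_isSwap _ _ _ hg,
        family_lin_of_not_isSwap _ _ _ (mt (isSwap_conj_iff h).1 hg)]
      simp
  const_invariant g h v w := by
    by_cases hg : g.IsSwap
    · rw [family_const_of_isSwap _ _ _ hg, family_const_of_isSwap _ _ _ (isSwap_conj hg h)]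
      obtain ⟨p, q, hpq, rfl⟩ := hg
      rw [reflForm_doubledStdRep_inv h hpq, conj_swap]
    by_cases hg' : IsCycle3 g
    · rw [family_const_of_isCycle3 _ _ _ hg', family_const_of_isCycle3 _ _ _ (isCycle3_conj hg' h)]
      obtain ⟨p, q, r, hpq, hqr, hpr, rfl⟩ := hg'
      rw [conj_cycle3, cycleForm_cycle3 a b hpq hqr hpr, cycleForm_cycle3 a b
        (h.injective.ne hpq) (h.injective.ne hqr) (h.injective.ne hpr)]
      rfl
    · rw [family_const_of_not _ _ _ hg hg', family_const_of_not _ _ _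
        (mt (isSwap_conj_iff h).1 hg) (mt (isCycle3_conj_iff h).1 hg')]
      simp
  mixed_jacobi g v₁ v₂ v₃ := by
    by_cases hg : g.IsSwap
    · simp only [family_lin_of_isSwap _ _ _ hg]
      obtain ⟨p, q, hpq, rfl⟩ := hg
      -- All values of `κ^L_g` are multiples of one vector, which factors out of the cyclic sum.
      have h := congrArg (fun v => SymmetricAlgebra.ι ℂ (DoubledStd n)
        ((-((n : ℂ) / 2)) • moved a b (swap p q)) * SymmetricAlgebra.ι ℂ (DoubledStd n) v)
        (cyclicSum_reflForm_smul hpq v₁ v₂ v₃)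
      simp only [map_zero, mul_zero] at h
      rw [← h]
      simp only [cyclicSum, map_add, map_smul, mul_add, smul_mul_assoc, mul_smul_comm, smul_smul,
        mul_comm (-((n : ℂ) / 2))]
    · simp only [family_lin_of_not_isSwap _ _ _ hg]
      simp [cyclicSum]
  first_obstruction g v₁ v₂ v₃ := by
    by_cases hg : IsCycle3 g
    · simp only [family_const_of_isCycle3 _ _ _ hg]
      obtain ⟨p, q, r, hpq, hqr, hpr, rfl⟩ := hg
      simp only [sum_family_lin_comp a b c hpq hqr hpr, mul_smul]
      have h := family_first_obstruction_cycle3 a b hpq hqr hpr v₁ v₂ v₃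
      simp only [cyclicSum] at h ⊢
      linear_combination (norm := module) ((n : ℂ) ^ 2 / 4) • h
    · simp only [family_lin_comp_eq_zero a b c _ _ _ hg, Finset.sum_const_zero]
      rw [cyclicSum_zero]
      by_cases hs : g.IsSwap
      · simp only [family_const_of_isSwap _ _ _ hs, mul_smul]
        obtain ⟨p, q, hpq, rfl⟩ := hs
        have h := cyclicSum_reflForm_smul hpq v₁ v₂ v₃
        simp only [cyclicSum] at h ⊢
        linear_combination (norm := module) (-2 * c) • h
      · simp only [family_const_of_not _ _ _ hs hg]
        simp [cyclicSum]
  second_obstruction g v₁ v₂ v₃ := by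
    by_cases hg : IsCycle3 g
    · obtain ⟨p, q, r, hpq, hqr, hpr, rfl⟩ := hg
      simp only [sum_family_const_comp a b c hpq hqr hpr, ← smul_eq_mul (-(c * (n : ℂ) / 2))]
      rw [cyclicSum_smul, cyclicSum_composite a b hpq hqr hpr, smul_zero]
    · simp only [family_const_comp_eq_zero a b c _ _ _ hg, Finset.sum_const_zero]
      rw [cyclicSum_zero]

end FamilyIsMap

/-! ### The homogeneous equation for scalar forms -/

section Homogeneous

/-- Pairing the mixed Jacobi identity with an invariant functional. -/
theorem cyclicSum_smul_eq_zero_of_mixed_jacobi {V : Type*} [AddCommGroup V] [Module ℂ V]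
    {D : V →ₗ[ℂ] V} {L : V → V → V}
    (h : ∀ v₁ v₂ v₃, cyclicSum (fun u v w => SymmetricAlgebra.ι ℂ V (L v w) *
      SymmetricAlgebra.ι ℂ V (D u - u)) v₁ v₂ v₃ = 0)
    {f : V →ₗ[ℂ] ℂ} (hf : ∀ v, f (D v) = f v) (v₁ v₂ v₃ : V) :
    cyclicSum (fun u v w => f (L v w) • (D u - u)) v₁ v₂ v₃ = 0 := by
  have key : ∀ e : V →ₗ[ℂ] ℂ,
      cyclicSum (fun u v w => e (L v w) * e (D u - u)) v₁ v₂ v₃ = 0 := by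
    intro e
    have := congrArg (SymmetricAlgebra.lift e) (h v₁ v₂ v₃)
    simpa only [cyclicSum, map_add, map_mul, SymmetricAlgebra.lift_ι_apply, map_zero] using this
  rw [← Module.forall_dual_apply_eq_zero_iff ℂ]
  intro e
  have h1 := key e
  -- Since `f` kills `D u - u`, the identities for `f + e` and `e` differ exactly by the sum of `f(L
  -- v w) e(D u - u)`.
  have h2 := key (f + e)
  simp only [cyclicSum, LinearMap.add_apply, map_sub, map_add, map_smul, hf, smul_eq_mul]
    at h1 h2 ⊢
  linear_combination h2 - h1

/-- Averaging over the powers of an element of finite order. -/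
theorem exists_invariant_functional {G V : Type*} [Group G] [Finite G] [AddCommGroup V]
    [Module ℂ V] (ρ : Representation ℂ G V) (g : G) (e : V →ₗ[ℂ] ℂ) :
    ∃ f : V →ₗ[ℂ] ℂ, (∀ v, f (ρ g v) = f v) ∧ ∀ v, ρ g v = v → f v = e v := by
  have hm : (orderOf g : ℂ) ≠ 0 := Nat.cast_ne_zero.2 (orderOf_pos g).ne'
  refine ⟨(orderOf g : ℂ)⁻¹ • ∑ k ∈ Finset.range (orderOf g), e ∘ₗ ρ (g ^ k), fun v => ?_,
    fun v hv => ?_⟩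
  · simp only [LinearMap.smul_apply, LinearMap.sum_apply, LinearMap.comp_apply]
    congr 1
    have h1 : ∀ k, ρ (g ^ k) (ρ g v) = ρ (g ^ (k + 1)) v := fun k => by
      rw [pow_succ, map_mul]; rfl
    simp only [h1]
    -- Splitting off the last or the first of the `orderOf g + 1` terms gives the same total, and
    -- these two terms agree because `g ^ orderOf g = 1`.
    have h2 := Finset.sum_range_succ (fun k => e (ρ (g ^ k) v)) (orderOf g)
    rw [Finset.sum_range_succ', pow_orderOf_eq_one, pow_zero] at h2
    exact add_right_cancel h2
  · have h1 : ∀ k, ρ (g ^ k) v = v := fun k => by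
      induction k with
      | zero => simp
      | succ k ih => rw [pow_succ, map_mul, Module.End.mul_apply, hv, ih]
    simp only [LinearMap.smul_apply, LinearMap.sum_apply, LinearMap.comp_apply, h1,
      Finset.sum_const, Finset.card_range, nsmul_eq_mul, smul_eq_mul]
    rw [inv_mul_cancel_left₀ hm]

variable {n : ℕ}

theorem bar_apply_ne {i k : Fin n} (h : k ≠ i) : (bar k).1 i ≠ (bar i).1 i := by
  rw [bar_apply, bar_apply, if_neg h.symm, if_pos rfl, Ne, sub_left_inj]
  exact zero_ne_one

/-- Take `k` where `g` differs from the transposition `(i g(i))`. The coordinate `m` detects the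
displacement of `i` but not that of `k`, so the two displacements are independent. -/
theorem exists_two_moved {g : Perm (Fin n)} (h1 : g ≠ 1) (hs : ¬ g.IsSwap) :
    ∃ i k m, g i ≠ i ∧ g k ≠ k ∧ (bar (g i)).1 m ≠ (bar i).1 m ∧
      (bar (g k)).1 m = (bar k).1 m := by
  obtain ⟨i, hi⟩ : ∃ i, g i ≠ i := by
    by_contra! h
    exact h1 (Equiv.ext h)
  obtain ⟨k, hk⟩ : ∃ k, g k ≠ swap i (g i) k := by
    by_contra! h
    exact hs ⟨i, g i, hi.symm, Equiv.ext h⟩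
  have hki : k ≠ i := by rintro rfl; simp at hk
  by_cases hkg : k = g i
  · subst hkg
    rw [swap_apply_right] at hk
    exact ⟨i, g i, i, hi, g.injective.ne hi, bar_apply_ne hi,
      by simp [bar_apply, hi.symm, hk.symm]⟩
  · rw [swap_apply_of_ne_of_ne hki hkg] at hk
    exact ⟨i, k, g i, hi, hk, (bar_apply_ne hi.symm).symm,
      by simp [bar_apply, hki.symm, Ne.symm hkg]⟩

/-- The fixed space of `g` has codimension at least 3 unless `g` is trivial or a transposition. -/
theorem not_forall_mem_span_pair {g : Perm (Fin n)} (h1 : g ≠ 1) (hs : ¬ g.IsSwap)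
    (v w : DoubledStd n) : ¬ ∀ u, doubledStdRep n g u - u ∈ Submodule.span ℂ {v, w} := by
  intro h
  obtain ⟨i, k, m, hi, hk, hm1, hm2⟩ := exists_two_moved h1 hs
  let e : Fin 3 → DoubledStd n :=
    ![xbar (g i) - xbar i, xbar (g k) - xbar k, ybar (g i) - ybar i]
  have he : LinearIndependent ℂ e := by
    rw [Fintype.linearIndependent_iff]
    intro z hz
    rw [Fin.sum_univ_three] at hz
    simp only [e, Matrix.cons_val_zero, Matrix.cons_val_one, Matrix.cons_val] at hz
    have hfst : ∀ l, z 0 * ((bar (g i)).1 l - (bar i).1 l) +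
        z 1 * ((bar (g k)).1 l - (bar k).1 l) = 0 := fun l => by
      have := congrArg (fun v : DoubledStd n => v.1.1 l) hz
      simpa [xbar, ybar] using this
    have hsnd : ∀ l, z 2 * ((bar (g i)).1 l - (bar i).1 l) = 0 := fun l => by
      have := congrArg (fun v : DoubledStd n => v.2.1 l) hz
      simpa [xbar, ybar] using this
    have z0 : z 0 = 0 := by
      have := hfst m
      rw [hm2, sub_self, mul_zero, add_zero] at this
      exact (mul_eq_zero.1 this).resolve_right (sub_ne_zero.2 hm1)
    have z1 : z 1 = 0 := by
      have := hfst k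
      rw [z0, zero_mul, zero_add] at this
      exact (mul_eq_zero.1 this).resolve_right (sub_ne_zero.2 (bar_apply_ne hk))
    have z2 : z 2 = 0 := (mul_eq_zero.1 (hsnd m)).resolve_right (sub_ne_zero.2 hm1)
    intro l
    fin_cases l <;> assumption
  have hle : Submodule.span ℂ (Set.range e) ≤ Submodule.span ℂ {v, w} := by
    rw [Submodule.span_le]
    rintro _ ⟨l, rfl⟩
    fin_cases l
    · have := h (xbar i)
      rwa [doubledStdRep_xbar] at this
    · have := h (xbar k)
      rwa [doubledStdRep_xbar] at this
    · have := h (ybar i)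
      rwa [doubledStdRep_ybar] at this
  have hrank := Submodule.finrank_mono hle
  rw [finrank_span_eq_card he, Fintype.card_fin] at hrank
  have h2 : Module.finrank ℂ (Submodule.span ℂ ({v, w} : Set (DoubledStd n))) ≤ 2 := by
    classical
    have h3 := finrank_span_finset_le_card (R := ℂ) ({v, w} : Finset (DoubledStd n))
    rw [Set.finrank, Finset.coe_pair] at h3
    exact h3.trans Finset.card_le_two
  omega

variable {δ : DoubledStd n →ₗ[ℂ] DoubledStd n →ₗ[ℂ] ℂ}

/-- If `δ v w ≠ 0`, the equation solves for `gu - u` in terms of `gv - v` and `gw - w` for every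
`u`, making the rank of `g - 1` at most 2. -/
theorem eq_zero_of_cyclicSum_smul {g : Perm (Fin n)} (h1 : g ≠ 1) (hs : ¬ g.IsSwap)
    (h : ∀ v₁ v₂ v₃, cyclicSum (fun u v w => δ v w • (doubledStdRep n g u - u)) v₁ v₂ v₃ = 0) :
    δ = 0 := by
  refine LinearMap.ext fun v => LinearMap.ext fun w => ?_
  by_contra h0
  change δ v w ≠ 0 at h0
  refine not_forall_mem_span_pair h1 hs (doubledStdRep n g v - v) (doubledStdRep n g w - w)
    fun u => ?_
  rw [Submodule.mem_span_pair]
  refine ⟨-(δ v w)⁻¹ * δ w u, -(δ v w)⁻¹ * δ u v, ?_⟩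
  have h2 := h u v w
  simp only [cyclicSum] at h2
  have h3 : (δ v w)⁻¹ * δ v w = 1 := inv_mul_cancel₀ h0
  have h4 : doubledStdRep n g u - u = ((δ v w)⁻¹ * δ v w) • (doubledStdRep n g u - u) := by
    rw [h3, one_smul]
  rw [h4]
  linear_combination (norm := module) (-(δ v w)⁻¹) • h2

theorem eq_reflForm_of_cyclicSum_smul (hδ : δ.IsAlt) {i j : Fin n} (hij : i ≠ j)
    (h : ∀ v₁ v₂ v₃, cyclicSum (fun u v w =>
      δ v w • (doubledStdRep n (swap i j) u - u)) v₁ v₂ v₃ = 0) (v w : DoubledStd n) :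
    δ v w = reflForm (swap i j) v w * δ (xbar i) (ybar i) := by
  have hx : ∀ u v w : DoubledStd n, δ v w * (u.1.1 j - u.1.1 i) + δ w u * (v.1.1 j - v.1.1 i) +
      δ u v * (w.1.1 j - w.1.1 i) = 0 := fun u v w => by
    have := congrArg (fun v : DoubledStd n => v.1.1 i) (h u v w)
    simpa [cyclicSum] using this
  have hy : ∀ u v w : DoubledStd n, δ v w * (u.2.1 j - u.2.1 i) + δ w u * (v.2.1 j - v.2.1 i) +
      δ u v * (w.2.1 j - w.2.1 i) = 0 := fun u v w => by
    have := congrArg (fun v : DoubledStd n => v.2.1 i) (h u v w)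
    simpa [cyclicSum] using this
  -- The `x`-part of `ȳ_i` is zero, so the `x`-equation loses one term and gives `δ(v, ȳ_i)`.
  -- Feeding this into the `y`-equation with `ȳ_i` as an argument gives `δ v w`.
  have h1 : ∀ v, δ v (ybar i) = (v.1.1 i - v.1.1 j) * δ (xbar i) (ybar i) := fun v => by
    have := hx (xbar i) v (ybar i)
    rw [← hδ.neg (ybar i) (xbar i)]
    simp [xbar, ybar, bar_apply, hij.symm] at this ⊢
    linear_combination -this
  have h2 := hy (ybar i) v w
  have h3 := h1 v
  have h4 := h1 w
  rw [← hδ.neg v (ybar i)] at h2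
  rw [h3, h4] at h2
  rw [reflForm_swap hij]
  simp [ybar, bar_apply, hij.symm] at h2 ⊢
  linear_combination -h2

end Homogeneous

/-! ### Classification of the maps with linear part off the identity -/

section Classification

variable {n : ℕ} {κ : ParamMap (Perm (Fin n)) (DoubledStd n)}

/-- Any functional agrees on the fixed space of `g` with an invariant one, and `κ^L_g` takes values
there, so vanishing can be tested on invariant functionals. -/
theorem lin_eq_zero_of_not_isSwap (hκ : IsDrinfeldOrbifoldAlgebraMap (doubledStdRep n) κ)
    {g : Perm (Fin n)} (h1 : g ≠ 1) (hs : ¬ g.IsSwap) : κ.lin g = 0 := by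
  refine LinearMap.ext fun v => LinearMap.ext fun w => ?_
  change κ.lin g v w = 0
  rw [← Module.forall_dual_apply_eq_zero_iff ℂ]
  intro e
  obtain ⟨f, hf, hfe⟩ := exists_invariant_functional (doubledStdRep n) g e
  have h := eq_zero_of_cyclicSum_smul (δ := (κ.lin g).compr₂ f) h1 hs
    (cyclicSum_smul_eq_zero_of_mixed_jacobi (hκ.mixed_jacobi g) hf)
  rw [← hfe _ (hκ.image_fixed g v w)]
  exact LinearMap.congr_fun (LinearMap.congr_fun h v) w

theorem lin_swap_eq (hκ : IsDrinfeldOrbifoldAlgebraMap (doubledStdRep n) κ) {i j : Fin n}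
    (hij : i ≠ j) (v w : DoubledStd n) :
    κ.lin (swap i j) v w =
      reflForm (swap i j) v w • κ.lin (swap i j) (xbar i) (ybar i) := by
  rw [← sub_eq_zero, ← Module.forall_dual_apply_eq_zero_iff ℂ]
  intro e
  obtain ⟨f, hf, hfe⟩ := exists_invariant_functional (doubledStdRep n) (swap i j) e
  have h := eq_reflForm_of_cyclicSum_smul (δ := (κ.lin (swap i j)).compr₂ f)
    (fun v => by simp [κ.lin_alt (swap i j) v]) hij
    (cyclicSum_smul_eq_zero_of_mixed_jacobi (hκ.mixed_jacobi _) hf) v w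
  simp only [LinearMap.compr₂_apply] at h
  rw [map_sub, map_smul, ← hfe _ (hκ.image_fixed _ v w), ← hfe _ (hκ.image_fixed _ _ _), h,
    smul_eq_mul, sub_self]

theorem doubledStdRep_lin_swap (hκ : IsDrinfeldOrbifoldAlgebraMap (doubledStdRep n) κ)
    (h : Perm (Fin n)) (i j : Fin n) :
    doubledStdRep n h (κ.lin (swap i j) (xbar i) (ybar i)) =
      κ.lin (swap (h i) (h j)) (xbar (h i)) (ybar (h i)) := by
  have := hκ.lin_invariant (swap i j) h (xbar (h i)) (ybar (h i))
  rwa [doubledStdRep_xbar, doubledStdRep_ybar, show h⁻¹ (h i) = i from h.symm_apply_apply i,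
    conj_swap] at this

/-- The vectors of `𝔥` invariant under the permutations that preserve `{i, j}`. -/
theorem stdSpace_apply_eq (u : stdSpace n) {i j k : Fin n} (hij : i ≠ j)
    (hji : u.1 j = u.1 i) (h : ∀ l, l ≠ i → l ≠ j → u.1 l = u.1 k) (m : Fin n) :
    u.1 m = (u.1 i - u.1 k) *
      ((if m = i then 1 else 0) + (if m = j then 1 else 0) - 2 / (n : ℂ)) := by
  have hn : (n : ℂ) ≠ 0 := Nat.cast_ne_zero.mpr (Nat.ne_zero_of_lt i.isLt)
  have hu : ∑ l, u.1 l = 0 := u.2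
  have h1 : ∀ l, u.1 l = u.1 k +
      (u.1 i - u.1 k) * ((if l = i then 1 else 0) + (if l = j then 1 else 0)) := fun l => by
    by_cases hi : l = i
    · subst hi; simp [hij]
    by_cases hj : l = j
    · subst hj; simp [hi, hji]
    simp [hi, hj, h l hi hj]
  have h2 : (n : ℂ) * u.1 k + (u.1 i - u.1 k) * 2 = 0 := by
    rw [← hu, Finset.sum_congr rfl fun l _ => h1 l]
    simp [Finset.sum_add_distrib, ← Finset.mul_sum]
    norm_num
  rw [h1 m]
  field_simp
  linear_combination h2

theorem exists_eq_moved {v : DoubledStd n} {i j k : Fin n} (hij : i ≠ j)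
    (h1 : doubledStdRep n (swap i j) v = v)
    (h2 : ∀ l, l ≠ i → l ≠ j → doubledStdRep n (swap k l) v = v) :
    ∃ a b : ℂ, v = moved a b (swap i j) := by
  refine ⟨v.1.1 i - v.1.1 k, v.2.1 i - v.2.1 k, doubledStd_ext (fun m => ?_) fun m => ?_⟩
  · rw [moved_swap_fst _ _ hij]
    refine stdSpace_apply_eq v.1 hij ?_ (fun l hli hlj => ?_) m
    · have := congrArg (fun v : DoubledStd n => v.1.1 i) h1
      simpa using this
    · have := congrArg (fun v : DoubledStd n => v.1.1 k) (h2 l hli hlj)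
      simpa using this
  · rw [moved_swap_snd _ _ hij]
    refine stdSpace_apply_eq v.2 hij ?_ (fun l hli hlj => ?_) m
    · have := congrArg (fun v : DoubledStd n => v.2.1 i) h1
      simpa using this
    · have := congrArg (fun v : DoubledStd n => v.2.1 k) (h2 l hli hlj)
      simpa using this

theorem smul_moved (z a b : ℂ) (g : Perm (Fin n)) :
    z • moved a b g = moved (z * a) (z * b) g := by
  simp only [moved, Finset.smul_sum, smul_add, smul_smul]

theorem exists_lin_eq_family (hn : 3 ≤ n)
    (hκ : IsDrinfeldOrbifoldAlgebraMap (doubledStdRep n) κ) (h1 : κ.lin 1 = 0) :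
    ∃ a b : ℂ, ∀ c, κ.lin = (family n a b c).lin := by
  have hn0 : (n : ℂ) ≠ 0 := Nat.cast_ne_zero.mpr (by omega)
  let i : Fin n := ⟨0, by omega⟩
  let j : Fin n := ⟨1, by omega⟩
  let k : Fin n := ⟨2, by omega⟩
  have hij : i ≠ j := by simp [i, j]
  have hki : k ≠ i := by simp [i, k]
  have hkj : k ≠ j := by simp [j, k]
  obtain ⟨a, b, hab⟩ := exists_eq_moved (k := k) hij
    (hκ.image_fixed (swap i j) (xbar i) (ybar i)) fun l hli hlj => by
      rw [doubledStdRep_lin_swap hκ, swap_apply_of_ne_of_ne hki.symm hli.symm,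
        swap_apply_of_ne_of_ne hkj.symm hlj.symm]
  -- The factor inverts the normalization `-(n/2)` in `family`. Other transpositions follow by
  -- conjugation.
  refine ⟨-(2 / n) * a, -(2 / n) * b, fun c => funext fun g => ?_⟩
  by_cases hs : g.IsSwap
  · refine LinearMap.ext fun v => LinearMap.ext fun w => ?_
    rw [family_lin_of_isSwap _ _ _ hs]
    obtain ⟨p, q, hpq, rfl⟩ := hs
    obtain ⟨h, rfl, rfl⟩ := exists_perm_map_pair hij hpq
    rw [lin_swap_eq hκ hpq, ← doubledStdRep_lin_swap hκ, hab, doubledStdRep_moved a b h hij,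
      ← smul_moved, smul_smul]
    congr 1
    field_simp
  · rw [family_lin_of_not_isSwap _ _ _ hs]
    by_cases hg : g = 1
    · rw [hg, h1]
    · exact lin_eq_zero_of_not_isSwap hκ hg hs

theorem sum_ybar : ∑ j : Fin n, ybar j = 0 := by
  refine doubledStd_ext (fun k => ?_) fun k => ?_
  · simp [ybar, Prod.fst_sum]
  · have hn : (n : ℂ) ≠ 0 := Nat.cast_ne_zero.mpr (Nat.ne_zero_of_lt k.isLt)
    simp [ybar, Prod.snd_sum, bar_apply, hn]

section InvariantForm

variable {δ : DoubledStd n →ₗ[ℂ] DoubledStd n →ₗ[ℂ] ℂ}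

/-- Applying `(i j)` exchanges the arguments, so the value equals its own negative. -/
theorem invariantForm_xbar_xbar
    (hinv : ∀ (h : Perm (Fin n)) v w, δ (doubledStdRep n h v) (doubledStdRep n h w) = δ v w)
    (hδ : δ.IsAlt) (i j : Fin n) : δ (xbar i) (xbar j) = 0 := by
  have h := hinv (swap i j) (xbar i) (xbar j)
  rw [doubledStdRep_xbar, doubledStdRep_xbar, swap_apply_left, swap_apply_right,
    ← hδ.neg (xbar i) (xbar j)] at h
  linear_combination (-1 / 2 : ℂ) * h

theorem invariantForm_ybar_ybar
    (hinv : ∀ (h : Perm (Fin n)) v w, δ (doubledStdRep n h v) (doubledStdRep n h w) = δ v w)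
    (hδ : δ.IsAlt) (i j : Fin n) : δ (ybar i) (ybar j) = 0 := by
  have h := hinv (swap i j) (ybar i) (ybar j)
  rw [doubledStdRep_ybar, doubledStdRep_ybar, swap_apply_left, swap_apply_right,
    ← hδ.neg (ybar i) (ybar j)] at h
  linear_combination (-1 / 2 : ℂ) * h

theorem invariantForm_xbar_ybar
    (hinv : ∀ (h : Perm (Fin n)) v w, δ (doubledStdRep n h v) (doubledStdRep n h w) = δ v w)
    {i j p q : Fin n} (hij : i ≠ j) (hpq : p ≠ q) :
    δ (xbar p) (ybar q) = δ (xbar i) (ybar j) := by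
  obtain ⟨h, rfl, rfl⟩ := exists_perm_map_pair hij hpq
  rw [← doubledStdRep_xbar, ← doubledStdRep_ybar, hinv]

/-- The invariant alternating forms on `𝔥* ⊕ 𝔥` are determined by a single value. -/
theorem invariantForm_eq_zero
    (hinv : ∀ (h : Perm (Fin n)) v w, δ (doubledStdRep n h v) (doubledStdRep n h w) = δ v w)
    (hδ : δ.IsAlt) {i j : Fin n} (hij : i ≠ j)
    (h0 : δ (xbar i) (ybar j) = 0) : δ = 0 := by
  refine isAlt_ext_bar hδ (fun _ => rfl) (fun p q _ => invariantForm_xbar_xbar hinv hδ p q)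
    (fun p q _ => invariantForm_ybar_ybar hinv hδ p q) fun p q => ?_
  change δ (xbar p) (ybar q) = 0
  rcases eq_or_ne p q with rfl | hpq
  · have h := congrArg (δ (xbar p)) (sum_ybar (n := n))
    rw [map_sum, map_zero, Finset.sum_eq_single p] at h
    · exact h
    · intro q _ hq
      rw [invariantForm_xbar_ybar hinv hij hq.symm, h0]
    · simp
  · rw [invariantForm_xbar_ybar hinv hij hpq, h0]

end InvariantForm

theorem family_lin_xbar_ybar (a b c : ℂ) {i j : Fin n} (hij : i ≠ j) :
    (family n a b c).lin (swap i j) (xbar i) (ybar i) =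
      (-((n : ℂ) / 2)) • moved a b (swap i j) := by
  rw [family_lin_of_isSwap _ _ _ ⟨i, j, hij, rfl⟩, reflForm_xbar_ybar hij]
  simp [hij.symm]

/-- Equal linear parts give equal left sides of the first obstruction, so the difference of the
constant parts solves the homogeneous equation. -/
theorem exists_const_eq_family (hκ : IsDrinfeldOrbifoldAlgebraMap (doubledStdRep n) κ) {a b : ℂ}
    (hlin : ∀ c, κ.lin = (family n a b c).lin) {i j : Fin n} (hij : i ≠ j) :
    ∃ c, ∀ g, g ≠ 1 → κ.const g = (family n a b c).const g := by
  have hfam := fun c => family_isDrinfeldOrbifoldAlgebraMap (n := n) a b c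
  have hdiff : ∀ c g v₁ v₂ v₃, cyclicSum (fun u v w =>
      (κ.const g - (family n a b c).const g) v w • (doubledStdRep n g u - u)) v₁ v₂ v₃ = 0 := by
    intro c g v₁ v₂ v₃
    have h1 := hκ.first_obstruction g v₁ v₂ v₃
    have h2 := (hfam c).first_obstruction g v₁ v₂ v₃
    rw [hlin c] at h1
    rw [h1] at h2
    have h3 := smul_right_injective (DoubledStd n) (two_ne_zero (α := ℂ)) h2
    simp only [cyclicSum, LinearMap.sub_apply] at h3 ⊢
    linear_combination (norm := module) h3
  refine ⟨κ.const (swap i j) (xbar i) (ybar i), fun g hg => ?_⟩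
  by_cases hs : g.IsSwap
  · refine LinearMap.ext fun v => LinearMap.ext fun w => ?_
    rw [family_const_of_isSwap _ _ _ hs]
    obtain ⟨p, q, hpq, rfl⟩ := hs
    -- Comparing with the member `c = 0`, whose constant part vanishes on transpositions, puts
    -- `κ.const` itself into the homogeneous equation.
    have h0 : (family n a b 0).const (swap p q) = 0 := by
      refine LinearMap.ext fun v => LinearMap.ext fun w => ?_
      rw [family_const_of_isSwap _ _ _ ⟨p, q, hpq, rfl⟩, zero_mul]
      rfl
    have h1 := hdiff 0 (swap p q)
    rw [h0, sub_zero] at h1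
    rw [eq_reflForm_of_cyclicSum_smul (κ.const_alt _) hpq h1 v w, mul_comm]
    congr 1
    obtain ⟨h, rfl, rfl⟩ := exists_perm_map_pair hij hpq
    rw [← conj_swap, ← hκ.const_invariant, doubledStdRep_xbar, doubledStdRep_ybar,
      show h⁻¹ (h i) = i from h.symm_apply_apply i]
  · exact sub_eq_zero.1 (eq_zero_of_cyclicSum_smul hg hs (hdiff _ g))

theorem const_one_eq_zero (hκ : IsDrinfeldOrbifoldAlgebraMap (doubledStdRep n) κ) {a b c : ℂ}
    (hab : a ≠ 0 ∨ b ≠ 0) (hlin : κ.lin = (family n a b c).lin)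
    (hconst : ∀ g, g ≠ 1 → κ.const g = (family n a b c).const g) {i j k : Fin n} (hij : i ≠ j)
    (hki : k ≠ i) (hkj : k ≠ j) : κ.const 1 = 0 := by
  have hn0 : (n : ℂ) ≠ 0 := Nat.cast_ne_zero.mpr (Nat.ne_zero_of_lt i.isLt)
  have hinv : ∀ (h : Perm (Fin n)) v w,
      κ.const 1 (doubledStdRep n h v) (doubledStdRep n h w) = κ.const 1 v w := by
    intro h v w
    have := hκ.const_invariant 1 h⁻¹ v w
    rwa [inv_inv, mul_one, inv_mul_cancel] at this
  have halt := κ.const_alt 1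
  have hsum : ∀ g u v w, ∑ x, κ.const x (u + doubledStdRep n (x⁻¹ * g) u)
      (κ.lin (x⁻¹ * g) v w) = κ.const 1 (u + doubledStdRep n g u) (κ.lin g v w) +
      ∑ x, (family n a b c).const x (u + doubledStdRep n (x⁻¹ * g) u)
        ((family n a b c).lin (x⁻¹ * g) v w) := by
    intro g u v w
    -- The constant parts of `κ` and `family` differ only at the identity, where that of `family` is
    -- zero.
    rw [← sub_eq_iff_eq_add, ← Finset.sum_sub_distrib, Finset.sum_eq_single 1]
    · rw [family_const_of_not _ _ _ not_isSwap_one not_isCycle3_one, inv_one, one_mul]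
      simp
    · intro x _ hx
      rw [hconst x hx, hlin, sub_self]
    · simp
  have hone : ∀ g v₁ v₂ v₃, cyclicSum (fun u v w =>
      κ.const 1 (u + doubledStdRep n g u) (κ.lin g v w)) v₁ v₂ v₃ = 0 := by
    intro g v₁ v₂ v₃
    have h1 := hκ.second_obstruction g v₁ v₂ v₃
    have h2 := (family_isDrinfeldOrbifoldAlgebraMap (n := n) a b c).second_obstruction g v₁ v₂ v₃
    simp only [hsum] at h1
    simp only [cyclicSum] at h1 h2 ⊢
    linear_combination h1 - h2
  have hg : (swap i j).IsSwap := ⟨i, j, hij, rfl⟩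
  -- vectors `u` fixed by `(i j)` are orthogonal to the image of `κ^L` at `(i j)`
  have horth : ∀ u : DoubledStd n, u.1.1 i = u.1.1 j → u.2.1 i = u.2.1 j →
      doubledStdRep n (swap i j) u = u → κ.const 1 u (moved a b (swap i j)) = 0 := by
    intro u h1 h2 hu
    have h := hone (swap i j) u (xbar i) (ybar i)
    have e1 : κ.lin (swap i j) (ybar i) u = 0 := by
      rw [hlin, family_lin_of_isSwap _ _ _ hg, reflForm_swap hij, h1, h2]
      simp
    have e2 : κ.lin (swap i j) u (xbar i) = 0 := by
      rw [hlin, family_lin_of_isSwap _ _ _ hg, reflForm_swap hij, h1, h2]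
      simp
    simp only [cyclicSum, e1, e2, map_zero, add_zero, hu] at h
    rw [hlin, family_lin_xbar_ybar a b c hij, map_smul, map_add, LinearMap.add_apply,
      ← two_mul, smul_eq_mul] at h
    have h3 : -((n : ℂ) / 2) ≠ 0 := neg_ne_zero.2 (div_ne_zero hn0 two_ne_zero)
    simpa [h3, hn0] using h
  have hswap : swap i j k = k := swap_apply_of_ne_of_ne hki hkj
  refine invariantForm_eq_zero hinv halt hki ?_
  -- Testing with `ȳ_k` leaves only the `x̄` part of `moved`, with coefficient `a`; testing with
  -- `x̄_k` leaves the part with coefficient `b`.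
  rcases hab with ha | hb
  · have h := horth (ybar k) (by simp [ybar]) (by simp [ybar, bar_apply, hki.symm, hkj.symm])
      (by rw [doubledStdRep_ybar, hswap])
    rw [moved_swap a b hij] at h
    simp only [map_add, map_smul, invariantForm_ybar_ybar hinv halt, smul_eq_mul] at h
    rw [← halt.neg (xbar i), ← halt.neg (xbar j), invariantForm_xbar_ybar hinv hki hki.symm,
      invariantForm_xbar_ybar hinv hki hkj.symm] at h
    have h' : a * κ.const 1 (xbar k) (ybar i) = 0 := by linear_combination (-1 / 2 : ℂ) * h
    exact (mul_eq_zero.1 h').resolve_left ha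
  · have h := horth (xbar k) (by simp [xbar, bar_apply, hki.symm, hkj.symm]) (by simp [xbar])
      (by rw [doubledStdRep_xbar, hswap])
    rw [moved_swap a b hij] at h
    simp only [map_add, map_smul, invariantForm_xbar_xbar hinv halt, smul_eq_mul] at h
    rw [invariantForm_xbar_ybar hinv hki hkj] at h
    have h' : b * κ.const 1 (xbar k) (ybar i) = 0 := by linear_combination (1 / 2 : ℂ) * h
    exact (mul_eq_zero.1 h').resolve_left hb

/-- Drinfeld orbifold algebra maps with nonzero linear part supported off the identity belong to
the three-parameter family. -/
theorem exists_eq_family (hn : 3 ≤ n) (hκ : IsDrinfeldOrbifoldAlgebraMap (doubledStdRep n) κ)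
    (h0 : κ.lin ≠ 0) (h1 : κ.lin 1 = 0) :
    ∃ a b c : ℂ, (a ≠ 0 ∨ b ≠ 0) ∧ κ = family n a b c := by
  obtain ⟨a, b, hlin⟩ := exists_lin_eq_family hn hκ h1
  have hab : a ≠ 0 ∨ b ≠ 0 := by
    by_contra! hab
    obtain ⟨rfl, rfl⟩ := hab
    refine h0 ?_
    rw [hlin 0]
    funext g
    by_cases hs : g.IsSwap
    · refine LinearMap.ext fun v => LinearMap.ext fun w => ?_
      rw [family_lin_of_isSwap _ _ _ hs]
      simp [moved]
    · exact family_lin_of_not_isSwap _ _ _ hs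
  let i : Fin n := ⟨0, by omega⟩
  let j : Fin n := ⟨1, by omega⟩
  let k : Fin n := ⟨2, by omega⟩
  have hij : i ≠ j := by simp [i, j]
  have hki : k ≠ i := by simp [i, k]
  have hkj : k ≠ j := by simp [j, k]
  obtain ⟨c, hc⟩ := exists_const_eq_family hκ hlin hij
  refine ⟨a, b, c, hab, ParamMap.ext (hlin c) (funext fun g => ?_)⟩
  by_cases hg : g = 1
  · rw [hg, const_one_eq_zero hκ hab (hlin c) hc hij hki hkj,
      family_const_of_not _ _ _ not_isSwap_one not_isCycle3_one]
  · exact hc g hg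

theorem family_lin_ne_zero (hn : 3 ≤ n) {a b : ℂ} (c : ℂ) (hab : a ≠ 0 ∨ b ≠ 0) :
    (family n a b c).lin ≠ 0 := by
  intro h
  have hn0 : (n : ℂ) ≠ 0 := Nat.cast_ne_zero.mpr (by omega)
  let i : Fin n := ⟨0, by omega⟩
  let j : Fin n := ⟨1, by omega⟩
  have hij : i ≠ j := by simp [i, j]
  have h1 := family_lin_xbar_ybar a b c hij
  rw [h] at h1
  have h2 : moved a b (swap i j) = 0 :=
    (smul_eq_zero.1 h1.symm).resolve_left (neg_ne_zero.2 (div_ne_zero hn0 two_ne_zero))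
  -- This is the coordinate of `moved` at `i`, up to the factor `a` or `b`; it would vanish for `n =
  -- 2`.
  have h3 : (1 : ℂ) - 2 / n ≠ 0 := by
    rw [sub_ne_zero, Ne, eq_comm, div_eq_one_iff_eq hn0]
    exact_mod_cast (by omega : 2 ≠ n)
  have h4 := moved_swap_fst a b hij i
  have h5 := moved_swap_snd a b hij i
  rw [h2] at h4 h5
  simp only [if_true, hij, if_false, add_zero] at h4 h5
  rcases hab with ha | hb
  · exact mul_ne_zero ha h3 h4.symm
  · exact mul_ne_zero hb h3 h5.symm

end Classification

end

end DrinfeldOrbifold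

theorem mainTheorem1 (n : ℕ) (hn : 4 ≤ n) :
    -- the maps with nonzero linear part supported only off the identity are exactly those of the
    -- family with `a` and `b` not both zero
    (∀ κ : DrinfeldOrbifold.ParamMap (Equiv.Perm (Fin n)) (DrinfeldOrbifold.DoubledStd n),
      (DrinfeldOrbifold.IsDrinfeldOrbifoldAlgebraMap (DrinfeldOrbifold.doubledStdRep n) κ ∧
        κ.lin ≠ 0 ∧ κ.lin 1 = 0) ↔
      ∃ a b c : ℂ, (a ≠ 0 ∨ b ≠ 0) ∧ DrinfeldOrbifold.InFamily a b c κ) ∧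
    -- every choice of the parameters defines exactly one map, which is a Drinfeld orbifold
    -- algebra map
    (∀ a b c : ℂ,
      (∃! κ : DrinfeldOrbifold.ParamMap (Equiv.Perm (Fin n)) (DrinfeldOrbifold.DoubledStd n),
        DrinfeldOrbifold.InFamily a b c κ) ∧
      ∀ κ : DrinfeldOrbifold.ParamMap (Equiv.Perm (Fin n)) (DrinfeldOrbifold.DoubledStd n),
        DrinfeldOrbifold.InFamily a b c κ →
        DrinfeldOrbifold.IsDrinfeldOrbifoldAlgebraMap (DrinfeldOrbifold.doubledStdRep n) κ) ∧
    -- for `a = b = 0` the family gives the commutator relations of `H_{0,c}`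
    (∀ (c : ℂ) (κ : DrinfeldOrbifold.ParamMap (Equiv.Perm (Fin n)) (DrinfeldOrbifold.DoubledStd n)),
      DrinfeldOrbifold.InFamily 0 0 c κ ↔ DrinfeldOrbifold.IsCherednikMap c κ) := by
  have hn3 : 3 ≤ n := by omega
  refine ⟨fun κ => ⟨?_, ?_⟩, fun a b c => ⟨?_, ?_⟩, DrinfeldOrbifold.inFamily_zero_iff⟩
  · rintro ⟨hκ, h0, h1⟩
    obtain ⟨a, b, c, hab, h⟩ := DrinfeldOrbifold.exists_eq_family hn3 hκ h0 h1
    exact ⟨a, b, c, hab, (DrinfeldOrbifold.inFamily_iff a b c κ).2 h⟩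
  · rintro ⟨a, b, c, hab, h⟩
    rw [DrinfeldOrbifold.inFamily_iff] at h
    subst h
    exact ⟨DrinfeldOrbifold.family_isDrinfeldOrbifoldAlgebraMap a b c,
      DrinfeldOrbifold.family_lin_ne_zero hn3 c hab,
      DrinfeldOrbifold.family_lin_of_not_isSwap a b c DrinfeldOrbifold.not_isSwap_one⟩
  · exact ⟨_, DrinfeldOrbifold.family_inFamily a b c,
      fun κ h => (DrinfeldOrbifold.inFamily_iff a b c κ).1 h⟩
  · intro κ h
    rw [(DrinfeldOrbifold.inFamily_iff a b c κ).1 h]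
    exact DrinfeldOrbifold.family_isDrinfeldOrbifoldAlgebraMap a b c
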